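/- For each sample size $n$ consider, conditionally on the instruments (which are treated as fixed, so all expectations are conditional on them), the linear IV model with one endogenous variable $$y_i=x_i\beta+\varepsilon_i,\qquad x_i=\Pi_i+v_i,\qquad i=1,\dots,n,$$ where the pairs $(\varepsilon_i,v_i)$ are independent across $i$, have mean zero and finite variances, and need not be identically distributed. All quantities, including $\beta$ and the probability space, may depend on $n$; $\beta_0\in\mathbb R$ is fixed. Let $H=(h_{ij})\in\mathbb R^{n\times n}$ be a non-random matrix with $h_{ii}=0$. Put $\varepsilon_i(\beta_0)=y_i-x_i\beta_0$, $$\rho_i=\frac{\operatorname{Cov}(\varepsilon_i(\beta_0),x_i)}{\operatorname{Var}(\varepsilon_i(\beta_0))},\quad r_i=x_i-\rho_i\varepsilon_i(\beta_0),\quad \hat r_i=x_i-\hat\rho_i\varepsilon_i(\beta_0),\quad \widehat\Pi^I_i=\sum_{j\ne i}h_{ij}r_j,\quad \widehat\Pi_i=\sum_{j\ne i}h_{ij}\hat r_j,$$ where $\hat\rho_1,\dots,\hat\rho_n$ are arbitrary real random variables (estimators of $\rho_1,\dots,\rho_n$), and $$JK(\beta_0)=\frac{\big(\sum_i\varepsilon_i(\beta_0)\widehat\Pi_i\big)^2}{\sum_i\varepsilon_i(\beta_0)^2\widehat\Pi_i^2}\mathbf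 1\Big\{\sum_i\varepsilon_i(\beta_0)^2\widehat\Pi_i^2>0\Big\},\qquad JK_I(\beta_0)=\frac{\big(\sum_i\varepsilon_i(\beta_0)\widehat\Pi^I_i\big)^2}{\sum_i\varepsilon_i(\beta_0)^2(\widehat\Pi^I_i)^2}\mathbf 1\Big\{\sum_i\varepsilon_i(\beta_0)^2(\widehat\Pi^I_i)^2>0\Big\}.$$ Let $\eta_i=(\beta-\beta_0)v_i+\varepsilon_i$, $\zeta_i=v_i-\rho_i\eta_i$, let $s_n>0$ be defined by $s_n^{-2}=\max_i\mathbb E[(\widehat\Pi^I_i)^2]$, and set $$\Delta_N=\frac{s_n}{\sqrt n}\sum_{i=1}^n\varepsilon_i(\beta_0)(\widehat\Pi_i-\widehat\Pi^I_i),\qquad \Delta_D=\frac{s_n^2}{n}\sum_{i=1}^n\varepsilon_i(\beta_0)^2\big(\widehat\Pi_i^2-(\widehat\Pi^I_i)^2\big).$$ Suppose there is a constant $c>1$, not depending on $n$, such that for all sufficiently large $n$: 1. (Moment conditions) for all $i$, $|\Pi_i|+|\beta-\beta_0|+|\rho_i|\le c$, and $c^{-1}\le\mathbb E[|\eta_i|^l|\zeta_i|^k]\le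 c$ for all integers $l,k\ge0$ with $l+k\le6$; 2. (Balanced design) $\mathbb E\big[\frac{s_n^2}{n}\sum_i(\widehat\Pi^I_i)^2\big]\ge c^{-1}$; $\max_i s_n^2\sum_{j\ne i}h_{ji}^2\le c$; and $\sum_{k=2}^n\lambda_k^2(HH')\big/\sum_{k=1}^n\lambda_k^2(HH')\ge c^{-1}$, where $\lambda_k(HH')$ is the $k$-th largest eigenvalue of $HH'$; 3. (Local identification) $P=(\beta-\beta_0)^2\,\mathbb E\big[\big(\frac{s_n}{\sqrt n}\sum_i\Pi_i\widehat\Pi^I_i\big)^2\big]\le c$ and $\max_i\mathbb E\big[\big(s_n\sum_{j\ne i}h_{ji}\varepsilon_j(\beta_0)\big)^2\big]\le c$. If $(\Delta_N,\Delta_D)\to0$ in probability as $n\to\infty$, then $|JK(\beta_0)-JK_I(\beta_0)|\to0$ in probability. -/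

import Mathlib

open MeasureTheory ProbabilityTheory Filter Topology

noncomputable section

namespace JackknifeIV

/-- The linear IV model with one endogenous variable and sample size `n`, conditional on the
instruments: `y i = x i * β + ε i` and `x i = Π i + v i`.  The pairs `(ε i, v i)` are independent
across `i`, centred and square integrable; they need not be identically distributed, and the
covariance matrix of `(ε i, v i)` is an arbitrary function of the observation. -/
structure IVModel (n : ℕ) {Ω : Type*} [MeasurableSpace Ω] (μ : Measure Ω) where
  /-- the structural parameter -/
  β : ℝ
  /-- the first stage `Π i = E[x i]` -/
  firstStage : Fin n → ℝ
  /-- the structural errors -/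
  ε : Fin n → Ω → ℝ
  /-- the first-stage errors -/
  v : Fin n → Ω → ℝ
  measurable_ε : ∀ i, Measurable (ε i)
  measurable_v : ∀ i, Measurable (v i)
  memLp_ε : ∀ i, MemLp (ε i) 2 μ
  memLp_v : ∀ i, MemLp (v i) 2 μ
  mean_ε : ∀ i, ∫ ω, ε i ω ∂μ = 0
  mean_v : ∀ i, ∫ ω, v i ω ∂μ = 0
  indep : iIndepFun (fun i ω => (ε i ω, v i ω)) μ

namespace IVModel

variable {n : ℕ} {Ω : Type*} [MeasurableSpace Ω] {μ : Measure Ω}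

/-- The endogenous variable `x i`. -/
def x (M : IVModel n μ) (i : Fin n) (ω : Ω) : ℝ := M.firstStage i + M.v i ω

/-- The outcome `y i`. -/
def y (M : IVModel n μ) (i : Fin n) (ω : Ω) : ℝ := M.x i ω * M.β + M.ε i ω

/-- The null error `ε i (β₀) = y i - x i * β₀`. -/
def nullError (M : IVModel n μ) (β₀ : ℝ) (i : Fin n) (ω : Ω) : ℝ := M.y i ω - M.x i ω * β₀

/-- The nuisance parameter `ρ(z i) = Cov(ε i (β₀), x i) / Var(ε i (β₀))`. -/
def ρ (M : IVModel n μ) (β₀ : ℝ) (i : Fin n) : ℝ :=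
  covariance (M.nullError β₀ i) (M.x i) μ / variance (M.nullError β₀ i) μ

/-- The partialled-out endogenous variable `r i = x i - ρ(z i) * ε i (β₀)`. -/
def r (M : IVModel n μ) (β₀ : ℝ) (i : Fin n) (ω : Ω) : ℝ :=
  M.x i ω - M.ρ β₀ i * M.nullError β₀ i ω

/-- The estimated version of `r i`, for an estimator `ρhat i` of `ρ(z i)`. -/
def rHat (M : IVModel n μ) (β₀ : ℝ) (ρhat : Fin n → Ω → ℝ) (i : Fin n) (ω : Ω) : ℝ :=
  M.x i ω - ρhat i ω * M.nullError β₀ i ω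

/-- `η i = (β - β₀) * v i + ε i`. -/
def η (M : IVModel n μ) (β₀ : ℝ) (i : Fin n) (ω : Ω) : ℝ := (M.β - β₀) * M.v i ω + M.ε i ω

/-- `ζ i = v i - ρ(z i) * η i`. -/
def ζ (M : IVModel n μ) (β₀ : ℝ) (i : Fin n) (ω : Ω) : ℝ := M.v i ω - M.ρ β₀ i * M.η β₀ i ω

/-- The infeasible first-stage estimate, the sum of `h i j * r j` over `j ≠ i`. -/
def piHatI (M : IVModel n μ) (H : Matrix (Fin n) (Fin n) ℝ) (β₀ : ℝ) (i : Fin n) (ω : Ω) : ℝ :=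
  ∑ j ∈ Finset.univ.erase i, H i j * M.r β₀ j ω

/-- The feasible first-stage estimate, the sum of `h i j * rHat j` over `j ≠ i`. -/
def piHat (M : IVModel n μ) (H : Matrix (Fin n) (Fin n) ℝ) (β₀ : ℝ) (ρhat : Fin n → Ω → ℝ)
    (i : Fin n) (ω : Ω) : ℝ :=
  ∑ j ∈ Finset.univ.erase i, H i j * M.rHat β₀ ρhat j ω

end IVModel

open Classical in
/-- The ratio `(∑ e i * p i)² / ∑ (e i)² * (p i)²`, set to `0` if the denominator is not positive. -/
def kRatio {n : ℕ} (e p : Fin n → ℝ) : ℝ :=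
  if 0 < ∑ i, e i ^ 2 * p i ^ 2 then (∑ i, e i * p i) ^ 2 / ∑ i, e i ^ 2 * p i ^ 2 else 0

namespace IVModel

variable {n : ℕ} {Ω : Type*} [MeasurableSpace Ω] {μ : Measure Ω}

/-- The feasible jackknife K-statistic `JK(β₀)`. -/
def JK (M : IVModel n μ) (H : Matrix (Fin n) (Fin n) ℝ) (β₀ : ℝ) (ρhat : Fin n → Ω → ℝ)
    (ω : Ω) : ℝ :=
  kRatio (fun i => M.nullError β₀ i ω) (fun i => M.piHat H β₀ ρhat i ω)

/-- The infeasible jackknife K-statistic `JK_I(β₀)`. -/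
def JKI (M : IVModel n μ) (H : Matrix (Fin n) (Fin n) ℝ) (β₀ : ℝ) (ω : Ω) : ℝ :=
  kRatio (fun i => M.nullError β₀ i ω) (fun i => M.piHatI H β₀ i ω)

/-- The scaling factor `s_n`, given by `s_n⁻² = max_i E[(piHatI i)²]`. -/
def scale (M : IVModel n μ) (H : Matrix (Fin n) (Fin n) ℝ) (β₀ : ℝ) : ℝ :=
  (Real.sqrt (⨆ i, ∫ ω, M.piHatI H β₀ i ω ^ 2 ∂μ))⁻¹

/-- The scaled numerator estimation error `Δ_N`. -/
def ΔN (M : IVModel n μ) (H : Matrix (Fin n) (Fin n) ℝ) (β₀ : ℝ) (ρhat : Fin n → Ω → ℝ)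
    (ω : Ω) : ℝ :=
  M.scale H β₀ / Real.sqrt n *
    ∑ i, M.nullError β₀ i ω * (M.piHat H β₀ ρhat i ω - M.piHatI H β₀ i ω)

/-- The scaled denominator estimation error `Δ_D`. -/
def ΔD (M : IVModel n μ) (H : Matrix (Fin n) (Fin n) ℝ) (β₀ : ℝ) (ρhat : Fin n → Ω → ℝ)
    (ω : Ω) : ℝ :=
  M.scale H β₀ ^ 2 / n *
    ∑ i, M.nullError β₀ i ω ^ 2 * (M.piHat H β₀ ρhat i ω ^ 2 - M.piHatI H β₀ i ω ^ 2)

/-- The local power index `P`. -/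
def powerIndex (M : IVModel n μ) (H : Matrix (Fin n) (Fin n) ℝ) (β₀ : ℝ) : ℝ :=
  (M.β - β₀) ^ 2 *
    ∫ ω, (M.scale H β₀ / Real.sqrt n * ∑ i, M.firstStage i * M.piHatI H β₀ i ω) ^ 2 ∂μ

/-- Moment conditions with constant `c`.  The lower bound makes each moment a genuine integral. -/
structure MomentConditions (M : IVModel n μ) (β₀ c : ℝ) : Prop where
  bounded : ∀ i, |M.firstStage i| + |M.β - β₀| + |M.ρ β₀ i| ≤ c
  moments : ∀ i, ∀ l k : ℕ, l + k ≤ 6 →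
    c⁻¹ ≤ ∫ ω, |M.η β₀ i ω| ^ l * |M.ζ β₀ i ω| ^ k ∂μ ∧
      ∫ ω, |M.η β₀ i ω| ^ l * |M.ζ β₀ i ω| ^ k ∂μ ≤ c

end IVModel

/-- `HH'` is a symmetric matrix. -/
theorem isHermitian_mul_transpose {n : ℕ} (H : Matrix (Fin n) (Fin n) ℝ) :
    (H * H.transpose).IsHermitian := by
  simpa using Matrix.isHermitian_mul_conjTranspose_self H

/-- The eigenvalues of `HH'` in decreasing order: `gramEigenvalue H k` is the `(k+1)`-st largest. -/
def gramEigenvalue {n : ℕ} (H : Matrix (Fin n) (Fin n) ℝ) (k : Fin (Fintype.card (Fin n))) : ℝ :=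
  (isHermitian_mul_transpose H).eigenvalues₀ k

namespace IVModel

variable {n : ℕ} {Ω : Type*} [MeasurableSpace Ω] {μ : Measure Ω}

/-- Balanced design with constant `c`.  Part `ratio` drops the largest eigenvalue, which has
index `0`, in the numerator. -/
structure BalancedDesign (M : IVModel n μ) (H : Matrix (Fin n) (Fin n) ℝ) (β₀ c : ℝ) : Prop where
  average : c⁻¹ ≤ ∫ ω, M.scale H β₀ ^ 2 / n * ∑ i, M.piHatI H β₀ i ω ^ 2 ∂μ
  leverage : ∀ i, M.scale H β₀ ^ 2 * ∑ j ∈ Finset.univ.erase i, H j i ^ 2 ≤ c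
  ratio : c⁻¹ ≤
    (∑ k ∈ Finset.univ.filter (fun k : Fin (Fintype.card (Fin n)) => 1 ≤ k.val), gramEigenvalue H k ^ 2) /
      ∑ k, gramEigenvalue H k ^ 2

/-- Local identification with constant `c`. -/
structure LocalIdentification (M : IVModel n μ) (H : Matrix (Fin n) (Fin n) ℝ) (β₀ c : ℝ) :
    Prop where
  power : M.powerIndex H β₀ ≤ c
  nullErrors : ∀ i,
    ∫ ω, (M.scale H β₀ * ∑ j ∈ Finset.univ.erase i, H j i * M.nullError β₀ j ω) ^ 2 ∂μ ≤ c

end IVModel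

/-- Convergence in probability to `0` of a sequence of random elements of `E`, the `n`-th of which
lives on its own probability space. -/
def TendstoInProbZero {Ω : ℕ → Type*} [∀ n, MeasurableSpace (Ω n)] (μ : ∀ n, Measure (Ω n))
    {E : Type*} [NormedAddCommGroup E] (X : ∀ n, Ω n → E) : Prop :=
  ∀ δ : ℝ, 0 < δ → Tendsto (fun n => μ n {ω | δ ≤ ‖X n ω‖}) atTop (𝓝 0)

end JackknifeIV

end

/-! After scaling, `JKI` is a ratio `N ^ 2 / D`, and `JK` is the same ratio with `N + ΔN` and `D +
ΔD`. Such a ratio is stable under perturbations that vanish in probability (`abs_sq_div_sub_le`)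
once `N` is bounded in probability and `D` is bounded away from zero in probability. The work lies
in these two facts.

The scaled fit is affine, `Q i = b i + ∑ j, a i j * ζ j`, with independent centred `ζ j`, zero
diagonal `a i i = 0`, and rows and columns of `a` of squared length at most `c`. Up to a drift
controlled by the power index, `N` is `n^(-1/2) ∑ η i * Q i`. Likewise `n D` is `∑ X i * Q i ^ 2`
with centred `X i`, plus `∑ τ i * Q i ^ 2` with `τ i ≥ c⁻¹`. By `weighted_sum_second_moment` the
centred sums have second moment `O(n)`, even though `X i` and `ζ i` may be dependent: centring
forces a factor `a i k * a k i` into each cross term, and these products sum to `O(n)`. This bounds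
`N` and reduces `D` to a small-ball estimate for `|b + a ζ|² / n`.

That quadratic form need not concentrate, so the estimate splits on whether the squared operator
norm of `a` exceeds `κ n`. If it does not, the variance of the form is small and the form stays near
its mean, which is at least `n / c` (`measureReal_sum_sq_le_of_forall`). If it does, the projection
on one direction is a linear form in the `ζ j` with coefficients of order `n^(-1/2)` and squared
coefficient sum at least `κ`, and a characteristic function argument shows that it is rarely near
any given point (`measureReal_abs_linear_le`, `measureReal_sum_sq_le_of_exists`). Taking `κ` small,
then the radius small, then `n` large gives the bound on `D`. -/

namespace JackknifeIV

/-! ### Factorization over disjoint groups of coordinates, and moments of linear forms. -/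

section Independence

variable {Ω ι : Type*} {m : ι → MeasurableSpace Ω}

lemma measurable_iSup_of_mem {S : Set ι} {j : ι} (hj : j ∈ S) {F : Ω → ℝ}
    (hF : Measurable[m j] F) : Measurable[⨆ j ∈ S, m j] F :=
  hF.mono (le_iSup₂ (f := fun j (_ : j ∈ S) => m j) j hj) le_rfl

lemma measurable_linear {S : Set ι} {ζ : ι → Ω → ℝ} (hζ : ∀ j, Measurable[m j] (ζ j))
    {s : Finset ι} (hs : ∀ j ∈ s, j ∈ S) (a : ι → ℝ) :
    Measurable[⨆ j ∈ S, m j] (fun ω => ∑ j ∈ s, a j * ζ j ω) :=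
  Finset.measurable_fun_sum s fun j hj =>
    (measurable_iSup_of_mem (hs j hj) (hζ j)).const_mul (a j)

variable [mΩ : MeasurableSpace Ω] {μ : Measure Ω}

/-- Functions of disjoint groups of independent σ-algebras are independent. -/
lemma indepFun_of_disjoint (hle : ∀ j, m j ≤ mΩ) (hind : iIndep m μ) {S T : Set ι}
    (hST : Disjoint S T) {F G : Ω → ℝ} (hF : Measurable[⨆ j ∈ S, m j] F)
    (hG : Measurable[⨆ j ∈ T, m j] G) : IndepFun F G μ :=
  (IndepFun_iff_Indep F G μ).2 <| indep_of_indep_of_le_left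
    (indep_of_indep_of_le_right (indep_iSup_of_disjoint hle hind hST) hG.comap_le) hF.comap_le

lemma measurable_of_iSup (hle : ∀ j, m j ≤ mΩ) {S : Set ι} {F : Ω → ℝ}
    (hF : Measurable[⨆ j ∈ S, m j] F) : Measurable F :=
  hF.mono (iSup₂_le fun j _ => hle j) le_rfl

lemma integrable_mul_of_disjoint (hle : ∀ j, m j ≤ mΩ) (hind : iIndep m μ) {S T : Set ι}
    (hST : Disjoint S T) {F G : Ω → ℝ} (hF : Measurable[⨆ j ∈ S, m j] F)
    (hG : Measurable[⨆ j ∈ T, m j] G) (hFi : Integrable F μ) (hGi : Integrable G μ) :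
    Integrable (fun ω => F ω * G ω) μ :=
  (indepFun_of_disjoint hle hind hST hF hG).integrable_mul hFi hGi

lemma integral_mul_of_disjoint (hle : ∀ j, m j ≤ mΩ) (hind : iIndep m μ) {S T : Set ι}
    (hST : Disjoint S T) {F G : Ω → ℝ} (hF : Measurable[⨆ j ∈ S, m j] F)
    (hG : Measurable[⨆ j ∈ T, m j] G) :
    ∫ ω, F ω * G ω ∂μ = (∫ ω, F ω ∂μ) * ∫ ω, G ω ∂μ :=
  (indepFun_of_disjoint hle hind hST hF hG).integral_fun_mul_eq_mul_integral
    (measurable_of_iSup hle hF).aestronglyMeasurable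
    (measurable_of_iSup hle hG).aestronglyMeasurable

variable [IsProbabilityMeasure μ]

lemma integrable_pow_of_memLp_four {f : Ω → ℝ} (hf : MemLp f 4 μ) {k : ℕ} (hk : k ≤ 4) :
    Integrable (fun ω => f ω ^ k) μ := by
  have h : MemLp f k μ := hf.mono_exponent (by exact_mod_cast hk)
  refine (h.integrable_norm_pow' (p := k)).mono (hf.1.pow k) (.of_forall fun ω => ?_)
  simp

/-- Second and fourth moments of a linear combination of independent centred variables. -/
lemma linear_moments (hle : ∀ j, m j ≤ mΩ) (hind : iIndep m μ) {ζ : ι → Ω → ℝ}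
    (hζ : ∀ j, Measurable[m j] (ζ j)) (h4 : ∀ j, MemLp (ζ j) 4 μ) (h0 : ∀ j, ∫ ω, ζ j ω ∂μ = 0)
    {K : ℝ} (hK : 1 ≤ K) (hK2 : ∀ j, ∫ ω, ζ j ω ^ 2 ∂μ ≤ K) (hK4 : ∀ j, ∫ ω, ζ j ω ^ 4 ∂μ ≤ K)
    (a : ι → ℝ) (s : Finset ι) :
    MemLp (fun ω => ∑ j ∈ s, a j * ζ j ω) 4 μ ∧ ∫ ω, ∑ j ∈ s, a j * ζ j ω ∂μ = 0 ∧
      ∫ ω, (∑ j ∈ s, a j * ζ j ω) ^ 2 ∂μ = ∑ j ∈ s, a j ^ 2 * ∫ ω, ζ j ω ^ 2 ∂μ ∧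
      ∫ ω, (∑ j ∈ s, a j * ζ j ω) ^ 4 ∂μ ≤ 3 * K ^ 2 * (∑ j ∈ s, a j ^ 2) ^ 2 := by
  classical
  induction s using Finset.induction_on with
  | empty => simp
  | insert l s hl ih =>
    obtain ⟨i4, i0, i2, iV⟩ := ih
    simp only [Finset.sum_insert hl]
    set F : Ω → ℝ := fun ω => ∑ j ∈ s, a j * ζ j ω with hF
    have hFm : Measurable[⨆ j ∈ (s : Set ι), m j] F := measurable_linear hζ (fun j hj => hj) a
    have hlm : Measurable[⨆ j ∈ ({l} : Set ι), m j] (ζ l) :=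
      measurable_iSup_of_mem (Set.mem_singleton l) (hζ l)
    have hdis : Disjoint (s : Set ι) {l} := by simpa using hl
    have hI : ∀ p q : ℕ, p ≤ 4 → q ≤ 4 → Integrable (fun ω => F ω ^ p * ζ l ω ^ q) μ :=
      fun p q hp hq => integrable_mul_of_disjoint hle hind hdis (hFm.pow_const p)
        (hlm.pow_const q) (integrable_pow_of_memLp_four i4 hp)
        (integrable_pow_of_memLp_four (h4 l) hq)
    have hE : ∀ p q : ℕ, ∫ ω, F ω ^ p * ζ l ω ^ q ∂μ = (∫ ω, F ω ^ p ∂μ) * ∫ ω, ζ l ω ^ q ∂μ :=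
      fun p q => integral_mul_of_disjoint hle hind hdis (hFm.pow_const p) (hlm.pow_const q)
    have hF1 : Integrable F μ := by simpa using integrable_pow_of_memLp_four i4 (k := 1)
    have hl1 : Integrable (ζ l) μ := by simpa using integrable_pow_of_memLp_four (h4 l) (k := 1)
    have hF2 := integrable_pow_of_memLp_four i4 (k := 2) (by norm_num)
    have hF4 := integrable_pow_of_memLp_four i4 (k := 4) (by norm_num)
    have hl2 := integrable_pow_of_memLp_four (h4 l) (k := 2) (by norm_num)
    have hl4 := integrable_pow_of_memLp_four (h4 l) (k := 4) (by norm_num)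
    have hp1 : ∫ ω, F ω ^ 1 ∂μ = 0 := by simpa using i0
    have hq1 : ∫ ω, ζ l ω ^ 1 ∂μ = 0 := by simpa using h0 l
    refine ⟨((h4 l).const_mul (a l)).add i4, ?_, ?_, ?_⟩
    · rw [integral_add (hl1.const_mul _) hF1, integral_const_mul, h0 l, i0]; simp
    · change ∫ ω, (a l * ζ l ω + F ω) ^ 2 ∂μ = _
      have e : ∀ ω, (a l * ζ l ω + F ω) ^ 2
          = a l ^ 2 * ζ l ω ^ 2 + 2 * a l * (F ω ^ 1 * ζ l ω ^ 1) + F ω ^ 2 := fun ω => by ring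
      simp_rw [e]
      rw [integral_add ((hl2.const_mul _).fun_add ((hI 1 1 (by norm_num) (by norm_num)).const_mul _))
        hF2, integral_add (hl2.const_mul _) ((hI 1 1 (by norm_num) (by norm_num)).const_mul _),
        integral_const_mul, integral_const_mul, hE, hp1, i2]
      ring
    · change ∫ ω, (a l * ζ l ω + F ω) ^ 4 ∂μ ≤ _
      -- The terms of odd degree in `ζ l` contain a mean-zero factor. The rest fit into `3 K² (V +
      -- a²)² = 3 K² V² + 6 K² a² V + 3 K² a⁴`, using `K ≤ K²`.
      have e : ∀ ω, (a l * ζ l ω + F ω) ^ 4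
          = a l ^ 4 * ζ l ω ^ 4 + 4 * a l ^ 3 * (F ω ^ 1 * ζ l ω ^ 3)
            + 6 * a l ^ 2 * (F ω ^ 2 * ζ l ω ^ 2) + 4 * a l * (F ω ^ 3 * ζ l ω ^ 1) + F ω ^ 4 :=
        fun ω => by ring
      simp_rw [e]
      have j13 := (hI 1 3 (by norm_num) (by norm_num)).const_mul (4 * a l ^ 3)
      have j22 := (hI 2 2 (by norm_num) (by norm_num)).const_mul (6 * a l ^ 2)
      have j31 := (hI 3 1 (by norm_num) (by norm_num)).const_mul (4 * a l)
      have j04 := hl4.const_mul (a l ^ 4)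
      rw [integral_add (((j04.fun_add j13).fun_add j22).fun_add j31) hF4,
        integral_add ((j04.fun_add j13).fun_add j22) j31, integral_add (j04.fun_add j13) j22,
        integral_add j04 j13, integral_const_mul, integral_const_mul, integral_const_mul,
        integral_const_mul, hE, hE, hE, hp1, hq1, i2]
      have hV : ∑ j ∈ s, a j ^ 2 * ∫ ω, ζ j ω ^ 2 ∂μ ≤ K * ∑ j ∈ s, a j ^ 2 := by
        rw [Finset.mul_sum]
        exact Finset.sum_le_sum fun j _ => by nlinarith [hK2 j, sq_nonneg (a j)]
      set V := ∑ j ∈ s, a j ^ 2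
      have hV0 : 0 ≤ V := Finset.sum_nonneg fun j _ => sq_nonneg _
      have hW0 : 0 ≤ ∑ j ∈ s, a j ^ 2 * ∫ ω, ζ j ω ^ 2 ∂μ :=
        Finset.sum_nonneg fun j _ => mul_nonneg (sq_nonneg _) (integral_nonneg fun ω => sq_nonneg _)
      have h1 : (∑ j ∈ s, a j ^ 2 * ∫ ω, ζ j ω ^ 2 ∂μ) * ∫ ω, ζ l ω ^ 2 ∂μ ≤ K * V * K :=
        mul_le_mul hV (hK2 l) (integral_nonneg fun ω => sq_nonneg _) (by positivity)
      have h2 : a l ^ 4 * ∫ ω, ζ l ω ^ 4 ∂μ ≤ a l ^ 4 * K ^ 2 :=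
        mul_le_mul_of_nonneg_left ((hK4 l).trans (by nlinarith)) (by positivity)
      have h3 := mul_le_mul_of_nonneg_left h1 (by positivity : 0 ≤ 6 * a l ^ 2)
      have h4' : 0 ≤ a l ^ 4 * K ^ 2 := by positivity
      nlinarith

end Independence

/-! ### Variance of quadratic forms, and cross moments of weighted summands. -/

section Moments

variable {Ω ι : Type*} {m : ι → MeasurableSpace Ω} [mΩ : MeasurableSpace Ω] {μ : Measure Ω}

lemma memLp_two_of_integrable_sq {f : Ω → ℝ} (hf : Measurable f)
    (h : Integrable (fun ω => f ω ^ 2) μ) : MemLp f 2 μ :=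
  (memLp_two_iff_integrable_sq hf.aestronglyMeasurable).2 h

variable [IsProbabilityMeasure μ]

/-- A centred quadratic form in independent variables has variance of the order of the squared
Frobenius norm of its matrix. -/
lemma quadratic_second_moment (hle : ∀ j, m j ≤ mΩ) (hind : iIndep m μ) {ζ : ι → Ω → ℝ}
    (hζ : ∀ j, Measurable[m j] (ζ j)) (h4 : ∀ j, MemLp (ζ j) 4 μ) (h0 : ∀ j, ∫ ω, ζ j ω ∂μ = 0)
    {K : ℝ} (hK : 1 ≤ K) (hK2 : ∀ j, ∫ ω, ζ j ω ^ 2 ∂μ ≤ K) (hK4 : ∀ j, ∫ ω, ζ j ω ^ 4 ∂μ ≤ K)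
    (B : ι → ι → ℝ) (hB : ∀ j k, B j k = B k j) (d : ι → ℝ) (s : Finset ι) :
    MemLp (fun ω => ∑ j ∈ s, ∑ k ∈ s, B j k * (ζ j ω * ζ k ω) + 2 * ∑ j ∈ s, d j * ζ j ω
        - ∑ j ∈ s, B j j * ∫ ω, ζ j ω ^ 2 ∂μ) 2 μ ∧
      ∫ ω, (∑ j ∈ s, ∑ k ∈ s, B j k * (ζ j ω * ζ k ω) + 2 * ∑ j ∈ s, d j * ζ j ω
        - ∑ j ∈ s, B j j * ∫ ω, ζ j ω ^ 2 ∂μ) ∂μ = 0 ∧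
      ∫ ω, (∑ j ∈ s, ∑ k ∈ s, B j k * (ζ j ω * ζ k ω) + 2 * ∑ j ∈ s, d j * ζ j ω
        - ∑ j ∈ s, B j j * ∫ ω, ζ j ω ^ 2 ∂μ) ^ 2 ∂μ
        ≤ 16 * K ^ 2 * ∑ j ∈ s, (B j j ^ 2 + d j ^ 2 + ∑ k ∈ s, B j k ^ 2) := by
  classical
  induction s using Finset.induction_on with
  | empty => simp
  | insert l s hl ih =>
    set σ : ι → ℝ := fun j => ∫ ω, ζ j ω ^ 2 ∂μ with hσ
    set F : Ω → ℝ := fun ω => ∑ j ∈ s, ∑ k ∈ s, B j k * (ζ j ω * ζ k ω)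
      + 2 * ∑ j ∈ s, d j * ζ j ω - ∑ j ∈ s, B j j * σ j with hF
    set L : Ω → ℝ := fun ω => d l + ∑ j ∈ s, B l j * ζ j ω with hL
    obtain ⟨i2, i0, iV⟩ := ih
    obtain ⟨L4, L0, L2, -⟩ := linear_moments hle hind hζ h4 h0 hK hK2 hK4 (B l) s
    -- Increment of the form when the coordinate `l` is added; symmetry of `B` merges the two mixed
    -- sums into `L`. It is a martingale difference: given the coordinates in `s` it has mean zero,
    -- hence is orthogonal to `F`, and the second moments add up.
    set D : Ω → ℝ := fun ω => B l l * (ζ l ω ^ 2 - σ l) + 2 * (L ω * ζ l ω) with hD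
    have hsplit : ∀ ω, ∑ j ∈ insert l s, ∑ k ∈ insert l s, B j k * (ζ j ω * ζ k ω)
        + 2 * ∑ j ∈ insert l s, d j * ζ j ω - ∑ j ∈ insert l s, B j j * ∫ ω, ζ j ω ^ 2 ∂μ = F ω + D ω := by
      intro ω
      simp only [Finset.sum_insert hl, Finset.sum_add_distrib, hF, hD, hL, hσ]
      have e1 : ∑ j ∈ s, B j l * (ζ j ω * ζ l ω) = (∑ j ∈ s, B l j * ζ j ω) * ζ l ω := by
        rw [Finset.sum_mul]; exact Finset.sum_congr rfl fun j _ => by rw [hB j l]; ring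
      have e2 : ∑ j ∈ s, B l j * (ζ l ω * ζ j ω) = (∑ j ∈ s, B l j * ζ j ω) * ζ l ω := by
        rw [Finset.sum_mul]; exact Finset.sum_congr rfl fun j _ => by ring
      rw [e1, e2]; ring
    have hsm : ∀ j ∈ s, Measurable[⨆ j ∈ (s : Set ι), m j] (ζ j) :=
      fun j hj => measurable_iSup_of_mem hj (hζ j)
    have hLm : Measurable[⨆ j ∈ (s : Set ι), m j] L :=
      (measurable_linear hζ (fun j hj => hj) (B l)).const_add _
    have hFm : Measurable[⨆ j ∈ (s : Set ι), m j] F := by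
      refine ((Finset.measurable_fun_sum s fun j hj => Finset.measurable_fun_sum s fun k hk =>
        ((hsm j hj).mul (hsm k hk)).const_mul _).add
        ((measurable_linear hζ (fun j hj => hj) d).const_mul 2)).sub_const _
    have hlm : Measurable[⨆ j ∈ ({l} : Set ι), m j] (ζ l) :=
      measurable_iSup_of_mem (Set.mem_singleton l) (hζ l)
    have hdis : Disjoint (s : Set ι) {l} := by simpa using hl
    have hl1 : Integrable (ζ l) μ := by simpa using integrable_pow_of_memLp_four (h4 l) (k := 1)
    have hl2 := integrable_pow_of_memLp_four (h4 l) (k := 2) (by norm_num)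
    have hl4 := integrable_pow_of_memLp_four (h4 l) (k := 4) (by norm_num)
    have hLs : Integrable (fun ω => (∑ j ∈ s, B l j * ζ j ω) ^ 2) μ :=
      integrable_pow_of_memLp_four L4 (by norm_num)
    have hL4 : MemLp L 4 μ := (memLp_const (d l)).add L4
    have hL2 : MemLp L 2 μ := hL4.mono_exponent (by norm_num)
    have hF1 : Integrable F μ := i2.integrable (by norm_num)
    have hLi : Integrable L μ := hL2.integrable (by norm_num)
    have hq1 : Integrable (fun ω => ζ l ω ^ 2 - σ l) μ := hl2.sub (integrable_const _)
    have hqm : Measurable[⨆ j ∈ ({l} : Set ι), m j] (fun ω => ζ l ω ^ 2 - σ l) :=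
      (hlm.pow_const 2).sub_const _
    have hLζ : Integrable (fun ω => L ω * ζ l ω) μ :=
      integrable_mul_of_disjoint hle hind hdis hLm hlm hLi hl1
    have hLζ2 : Integrable (fun ω => L ω ^ 2 * ζ l ω ^ 2) μ :=
      integrable_mul_of_disjoint hle hind hdis (hLm.pow_const 2) (hlm.pow_const 2)
        hL2.integrable_sq hl2
    have hqe : ∀ ω, (ζ l ω ^ 2 - σ l) ^ 2 = ζ l ω ^ 4 - 2 * σ l * ζ l ω ^ 2 + σ l ^ 2 :=
      fun ω => by ring
    have hq2 : Integrable (fun ω => (ζ l ω ^ 2 - σ l) ^ 2) μ := by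
      simp_rw [hqe]; exact (hl4.sub (hl2.const_mul _)).add (integrable_const _)
    have hq0 : ∫ ω, (ζ l ω ^ 2 - σ l) ∂μ = 0 := by
      rw [integral_sub hl2 (integrable_const _)]; simp [hσ]
    have hqV : ∫ ω, (ζ l ω ^ 2 - σ l) ^ 2 ∂μ ≤ K := by
      have hsub : Integrable (fun ω => ζ l ω ^ 4 - 2 * σ l * ζ l ω ^ 2) μ :=
        hl4.sub (hl2.const_mul _)
      simp_rw [hqe]
      rw [integral_add hsub (integrable_const _),
        integral_sub hl4 (hl2.const_mul _), integral_const_mul]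
      have : ∫ ω, ζ l ω ^ 2 ∂μ = σ l := rfl
      rw [this]; simp only [integral_const, probReal_univ, one_smul]
      nlinarith [hK4 l, sq_nonneg (σ l)]
    have hqL : MemLp (fun ω => ζ l ω ^ 2 - σ l) 2 μ :=
      memLp_two_of_integrable_sq (measurable_of_iSup hle hqm) hq2
    have hLζL : MemLp (fun ω => L ω * ζ l ω) 2 μ :=
      memLp_two_of_integrable_sq ((measurable_of_iSup hle hLm).mul (measurable_of_iSup hle hlm))
        (by simpa [mul_pow] using hLζ2)
    have hDL : MemLp D 2 μ := (hqL.const_mul (B l l)).add (hLζL.const_mul 2)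
    have hD0 : ∫ ω, D ω ∂μ = 0 := by
      simp only [hD]
      rw [integral_add (hq1.const_mul _) (hLζ.const_mul _), integral_const_mul,
        integral_const_mul, hq0, integral_mul_of_disjoint hle hind hdis hLm hlm, h0 l]
      simp
    have hFq : ∫ ω, F ω * (ζ l ω ^ 2 - σ l) ∂μ = 0 := by
      rw [integral_mul_of_disjoint hle hind hdis hFm hqm, hq0, mul_zero]
    have hFLm : Measurable[⨆ j ∈ (s : Set ι), m j] (fun ω => F ω * L ω) := hFm.mul hLm
    have hFL : ∫ ω, F ω * L ω * ζ l ω ∂μ = 0 := by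
      rw [integral_mul_of_disjoint hle hind hdis hFLm hlm, h0 l, mul_zero]
    have hFqi : Integrable (fun ω => F ω * (ζ l ω ^ 2 - σ l)) μ := i2.integrable_mul hqL
    have hFLi : Integrable (fun ω => F ω * L ω * ζ l ω) μ :=
      integrable_mul_of_disjoint hle hind hdis hFLm hlm (i2.integrable_mul hL2) hl1
    have hFD : ∫ ω, F ω * D ω ∂μ = 0 := by
      have e : ∀ ω, F ω * D ω
          = B l l * (F ω * (ζ l ω ^ 2 - σ l)) + 2 * (F ω * L ω * ζ l ω) := fun ω => by
        simp only [hD]; ring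
      simp_rw [e]
      rw [integral_add (hFqi.const_mul _) (hFLi.const_mul _), integral_const_mul,
        integral_const_mul, hFq, hFL]
      simp
    have hLV : ∫ ω, L ω ^ 2 ∂μ ≤ 2 * d l ^ 2 + 2 * (K * ∑ j ∈ s, B l j ^ 2) := by
      have h1 : ∫ ω, L ω ^ 2 ∂μ
          ≤ ∫ ω, (2 * d l ^ 2 + 2 * (∑ j ∈ s, B l j * ζ j ω) ^ 2) ∂μ := by
        refine integral_mono hL2.integrable_sq ((integrable_const _).fun_add (hLs.const_mul _))
          fun ω => ?_
        simp only [hL]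
        nlinarith [sq_nonneg (d l - ∑ j ∈ s, B l j * ζ j ω)]
      rw [integral_add (integrable_const _) (hLs.const_mul _), integral_const, integral_const_mul,
        L2] at h1
      have h2 : ∑ j ∈ s, B l j ^ 2 * ∫ ω, ζ j ω ^ 2 ∂μ ≤ K * ∑ j ∈ s, B l j ^ 2 := by
        rw [Finset.mul_sum]
        exact Finset.sum_le_sum fun j _ => by nlinarith [hK2 j, sq_nonneg (B l j)]
      simp only [probReal_univ, one_smul] at h1
      linarith
    -- `(x + y)² ≤ 2 x² + 2 y²`, applied here and to `L`, gives `2 K B² + 16 K d² + 16 K² ∑ B²`; `K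
    -- ≤ K²` then gives the common constant.
    have hDV : ∫ ω, D ω ^ 2 ∂μ
        ≤ 16 * K ^ 2 * (B l l ^ 2 + d l ^ 2 + ∑ j ∈ s, B l j ^ 2) := by
      have h1 : ∫ ω, D ω ^ 2 ∂μ
          ≤ ∫ ω, (2 * B l l ^ 2 * (ζ l ω ^ 2 - σ l) ^ 2 + 8 * (L ω ^ 2 * ζ l ω ^ 2)) ∂μ := by
        refine integral_mono hDL.integrable_sq
          ((hq2.const_mul _).fun_add (hLζ2.const_mul _)) fun ω => ?_
        simp only [hD]
        nlinarith [sq_nonneg (B l l * (ζ l ω ^ 2 - σ l) - 2 * (L ω * ζ l ω))]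
      rw [integral_add (hq2.const_mul _) (hLζ2.const_mul _), integral_const_mul,
        integral_const_mul, integral_mul_of_disjoint hle hind hdis (hLm.pow_const 2)
        (hlm.pow_const 2)] at h1
      have hS0 : 0 ≤ ∑ j ∈ s, B l j ^ 2 := Finset.sum_nonneg fun j _ => sq_nonneg _
      have h2 : (∫ ω, L ω ^ 2 ∂μ) * ∫ ω, ζ l ω ^ 2 ∂μ
          ≤ (2 * d l ^ 2 + 2 * (K * ∑ j ∈ s, B l j ^ 2)) * K :=
        mul_le_mul hLV (hK2 l) (integral_nonneg fun ω => sq_nonneg _) (by positivity)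
      have h3 := mul_le_mul_of_nonneg_left hqV (by positivity : 0 ≤ 2 * B l l ^ 2)
      have hKK : K ≤ K ^ 2 := by nlinarith
      have h5 := mul_le_mul_of_nonneg_left hKK (sq_nonneg (B l l))
      have h6 := mul_le_mul_of_nonneg_left hKK (sq_nonneg (d l))
      have h7 : 0 ≤ B l l ^ 2 * K ^ 2 := by positivity
      nlinarith
    simp only [hsplit]
    refine ⟨i2.add hDL, ?_, ?_⟩
    · rw [integral_add hF1 (hDL.integrable (by norm_num)), i0, hD0, add_zero]
    · have e : ∀ ω, (F ω + D ω) ^ 2 = F ω ^ 2 + 2 * (F ω * D ω) + D ω ^ 2 := fun ω => by ring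
      have hFDi : Integrable (fun ω => F ω * D ω) μ := i2.integrable_mul hDL
      simp_rw [e]
      rw [integral_add (i2.integrable_sq.fun_add (hFDi.const_mul _)) hDL.integrable_sq,
        integral_add i2.integrable_sq (hFDi.const_mul _), integral_const_mul, hFD]
      have hmono : ∑ j ∈ s, (B j j ^ 2 + d j ^ 2 + ∑ k ∈ s, B j k ^ 2)
          ≤ ∑ j ∈ s, (B j j ^ 2 + d j ^ 2 + ∑ k ∈ insert l s, B j k ^ 2) :=
        Finset.sum_le_sum fun j _ => by
          rw [Finset.sum_insert hl]; nlinarith [sq_nonneg (B j l)]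
      have hl' : B l l ^ 2 + d l ^ 2 + ∑ k ∈ s, B l k ^ 2
          ≤ B l l ^ 2 + d l ^ 2 + ∑ k ∈ insert l s, B l k ^ 2 := by
        rw [Finset.sum_insert hl]; nlinarith [sq_nonneg (B l l)]
      have := mul_le_mul_of_nonneg_left (add_le_add hl' hmono)
        (by positivity : 0 ≤ 16 * K ^ 2)
      rw [Finset.sum_insert hl]
      linarith

/-- Mixed moments of two summands that share two coordinates, one of them centred for each. -/
lemma abs_integral_cross_le (hle : ∀ j, m j ≤ mΩ) (hind : iIndep m μ) {i k : ι} (hik : i ≠ k)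
    {X U Y V A B : Ω → ℝ} (hX : Measurable[m i] X) (hU : Measurable[m i] U)
    (hY : Measurable[m k] Y) (hV : Measurable[m k] V)
    (hA : Measurable[⨆ j ∈ ({i, k}ᶜ : Set ι), m j] A)
    (hB : Measurable[⨆ j ∈ ({i, k}ᶜ : Set ι), m j] B) (hA4 : MemLp A 4 μ) (hB4 : MemLp B 4 μ)
    {K : ℝ} (hAK : ∫ ω, A ω ^ 4 ∂μ ≤ K) (hBK : ∫ ω, B ω ^ 4 ∂μ ≤ K)
    {J : ℝ} (hXU : ∀ q ≤ 2, Integrable (fun ω => X ω * U ω ^ q) μ)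
    (hYV : ∀ q ≤ 2, Integrable (fun ω => Y ω * V ω ^ q) μ)
    (hXJ : ∀ q ≤ 2, |∫ ω, X ω * U ω ^ q ∂μ| ≤ J) (hYJ : ∀ q ≤ 2, |∫ ω, Y ω * V ω ^ q ∂μ| ≤ J)
    (hX0 : ∫ ω, X ω ∂μ = 0) (hY0 : ∫ ω, Y ω ∂μ = 0) {d : ℕ} (hd : d ≤ 2)
    {a b L : ℝ} (hL : 1 ≤ L) (ha : |a| ≤ L) (hb : |b| ≤ L) :
    Integrable (fun ω => (X ω * (A ω + a * V ω) ^ d) * (Y ω * (B ω + b * U ω) ^ d)) μ ∧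
      |∫ ω, (X ω * (A ω + a * V ω) ^ d) * (Y ω * (B ω + b * U ω) ^ d) ∂μ|
        ≤ 16 * (L ^ 2 * |a| * |b| * (4 + 4 * K) * J ^ 2) := by
  have hJ : 0 ≤ J := (abs_nonneg _).trans (hXJ 0 (by norm_num))
  have hK : 0 ≤ K := (integral_nonneg fun ω => by positivity).trans hAK
  set W : ℕ → ℕ → Ω → ℝ := fun p q ω => A ω ^ p * B ω ^ q with hW
  have hWm : ∀ p q, Measurable[⨆ j ∈ ({i, k}ᶜ : Set ι), m j] (W p q) :=
    fun p q => (hA.pow_const p).mul (hB.pow_const q)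
  have hA4i := integrable_pow_of_memLp_four hA4 le_rfl
  have hB4i := integrable_pow_of_memLp_four hB4 le_rfl
  have hWb : ∀ p q, p ≤ 2 → q ≤ 2 → ∀ ω, |W p q ω| ≤ 4 + 2 * A ω ^ 4 + 2 * B ω ^ 4 := by
    intro p q hp hq ω
    have hpow : ∀ (x : ℝ) (r : ℕ), r ≤ 2 → |x ^ r| ≤ 1 + x ^ 2 := by
      intro x r hr
      interval_cases r
      · simpa using sq_nonneg x
      · rw [pow_one, ← sq_abs]; nlinarith [sq_nonneg (|x| - 1), abs_nonneg x]
      · rw [abs_of_nonneg (sq_nonneg x)]; linarith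
    simp only [hW, abs_mul]
    have h1 := mul_le_mul (hpow (A ω) p hp) (hpow (B ω) q hq) (abs_nonneg _) (by positivity)
    nlinarith [sq_nonneg (A ω ^ 2 - 1), sq_nonneg (B ω ^ 2 - 1), sq_nonneg (A ω ^ 2 - B ω ^ 2)]
  have hbi : Integrable (fun ω => 4 + 2 * A ω ^ 4 + 2 * B ω ^ 4) μ :=
    ((integrable_const _).fun_add (hA4i.const_mul _)).fun_add (hB4i.const_mul _)
  have hWi : ∀ p q, p ≤ 2 → q ≤ 2 → Integrable (W p q) μ := fun p q hp hq =>
    hbi.mono' (measurable_of_iSup hle (hWm p q)).aestronglyMeasurable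
      (.of_forall fun ω => hWb p q hp hq ω)
  have hWJ : ∀ p q, p ≤ 2 → q ≤ 2 → |∫ ω, W p q ω ∂μ| ≤ 4 + 4 * K := by
    intro p q hp hq
    refine abs_integral_le_integral_abs.trans ((integral_mono (hWi p q hp hq).abs hbi
      fun ω => hWb p q hp hq ω).trans ?_)
    rw [integral_add ((integrable_const _).fun_add (hA4i.const_mul _)) (hB4i.const_mul _),
      integral_add (integrable_const _) (hA4i.const_mul _), integral_const_mul, integral_const_mul]
    simp only [integral_const, probReal_univ, one_smul]
    linarith
  set f : ℕ → Ω → ℝ := fun q ω => X ω * U ω ^ q with hf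
  set g : ℕ → Ω → ℝ := fun q ω => Y ω * V ω ^ q with hg
  have hfm : ∀ q, Measurable[⨆ j ∈ ({i} : Set ι), m j] (f q) := fun q =>
    measurable_iSup_of_mem (Set.mem_singleton i) (hX.mul (hU.pow_const q))
  have hgm : ∀ q, Measurable[⨆ j ∈ ({k} : Set ι), m j] (g q) := fun q =>
    measurable_iSup_of_mem (Set.mem_singleton k) (hY.mul (hV.pow_const q))
  have hfgm : ∀ p q, Measurable[⨆ j ∈ ({i, k} : Set ι), m j] (fun ω => f p ω * g q ω) :=
    fun p q => (measurable_iSup_of_mem (by simp) (hX.mul (hU.pow_const p))).mul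
      (measurable_iSup_of_mem (by simp) (hY.mul (hV.pow_const q)))
  have hdis1 : Disjoint ({i} : Set ι) {k} := by simpa using hik
  have hdis2 : Disjoint ({i, k}ᶜ : Set ι) {i, k} := disjoint_compl_left
  have hti : ∀ p q r t, p ≤ 2 → q ≤ 2 → r ≤ 2 → t ≤ 2 →
      Integrable (fun ω => W p q ω * (f r ω * g t ω)) μ := fun p q r t hp hq hr ht =>
    integrable_mul_of_disjoint hle hind hdis2 (hWm p q) (hfgm r t) (hWi p q hp hq)
      (integrable_mul_of_disjoint hle hind hdis1 (hfm r) (hgm t) (hXU r hr) (hYV t ht))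
  have htE : ∀ p q r t, ∫ ω, W p q ω * (f r ω * g t ω) ∂μ
      = (∫ ω, W p q ω ∂μ) * ((∫ ω, f r ω ∂μ) * ∫ ω, g t ω ∂μ) := fun p q r t => by
    rw [integral_mul_of_disjoint hle hind hdis2 (hWm p q) (hfgm r t),
      integral_mul_of_disjoint hle hind hdis1 (hfm r) (hgm t)]
  set co : ℕ → ℕ → ℝ := fun p q => (d.choose p * d.choose q : ℝ) * (a ^ (d - p) * b ^ (d - q))
    with hco
  have hexp : ∀ ω, (X ω * (A ω + a * V ω) ^ d) * (Y ω * (B ω + b * U ω) ^ d)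
      = ∑ p ∈ Finset.range (d + 1), ∑ q ∈ Finset.range (d + 1),
        co p q * (W p q ω * (f (d - q) ω * g (d - p) ω)) := by
    intro ω
    rw [add_pow, add_pow, mul_mul_mul_comm, Finset.sum_mul_sum, Finset.mul_sum]
    refine Finset.sum_congr rfl fun p _ => ?_
    rw [Finset.mul_sum]
    refine Finset.sum_congr rfl fun q _ => ?_
    simp only [hco, hW, hf, hg, mul_pow]; ring
  have hint : ∀ p ∈ Finset.range (d + 1), ∀ q ∈ Finset.range (d + 1),
      Integrable (fun ω => co p q * (W p q ω * (f (d - q) ω * g (d - p) ω))) μ := by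
    intro p hp q hq
    rw [Finset.mem_range] at hp hq
    exact (hti p q _ _ (by omega) (by omega) (by omega) (by omega)).const_mul _
  simp_rw [hexp]
  refine ⟨integrable_finsetSum _ fun p hp => integrable_finsetSum _ fun q hq => hint p hp q hq, ?_⟩
  rw [integral_finsetSum _ fun p hp => integrable_finsetSum _ fun q hq => hint p hp q hq]
  set T : ℝ := L ^ 2 * |a| * |b| * (4 + 4 * K) * J ^ 2 with hT
  have hT0 : 0 ≤ T := by positivity
  -- Exactly one power of the small coefficient is kept; the other, if present, is absorbed in `L`.
  have hpw : ∀ {x : ℝ} {r : ℕ}, |x| ≤ L → r ≤ 2 → r ≠ 0 → |x ^ r| ≤ L * |x| := by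
    intro x r hx hr hr0
    rw [abs_pow]
    interval_cases r
    · exact absurd rfl hr0
    · nlinarith [abs_nonneg x]
    · nlinarith [abs_nonneg x]
  have hterm : ∀ p ∈ Finset.range (d + 1), ∀ q ∈ Finset.range (d + 1),
      |∫ ω, co p q * (W p q ω * (f (d - q) ω * g (d - p) ω)) ∂μ|
        ≤ (d.choose p : ℝ) * (d.choose q : ℝ) * T := by
    intro p hp q hq
    rw [Finset.mem_range] at hp hq
    rw [integral_const_mul, htE]
    -- With `p = d` the factor `Y` stands alone, with `q = d` the factor `X` does, and the term
    -- vanishes by centring. Every surviving term therefore carries at least one factor `a` and one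
    -- factor `b`.
    by_cases hpd : d - p = 0
    · have : ∫ ω, g (d - p) ω ∂μ = 0 := by simpa [hpd, hg] using hY0
      rw [this]; simpa using by positivity
    by_cases hqd : d - q = 0
    · have : ∫ ω, f (d - q) ω ∂μ = 0 := by simpa [hqd, hf] using hX0
      rw [this]; simpa using by positivity
    simp only [hco, abs_mul, Nat.abs_cast]
    have h1 := hpw ha (by omega : d - p ≤ 2) hpd
    have h2 := hpw hb (by omega : d - q ≤ 2) hqd
    have h3 := hWJ p q (by omega) (by omega)
    have h4 : |∫ ω, f (d - q) ω ∂μ| ≤ J := hXJ _ (by omega)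
    have h5 : |∫ ω, g (d - p) ω ∂μ| ≤ J := hYJ _ (by omega)
    have h6 := mul_le_mul h1 h2 (abs_nonneg _) (by positivity)
    have h7 := mul_le_mul h4 h5 (abs_nonneg _) hJ
    have h8 := mul_le_mul h3 h7 (by positivity) (by positivity)
    have h9 := mul_le_mul h6 h8 (by positivity) (by positivity)
    rw [mul_assoc ((d.choose p : ℝ) * (d.choose q : ℝ))]
    refine mul_le_mul_of_nonneg_left (h9.trans (le_of_eq ?_)) (by positivity)
    rw [hT]; ring
  have hsum : ∑ p ∈ Finset.range (d + 1), ∑ q ∈ Finset.range (d + 1),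
      (d.choose p : ℝ) * (d.choose q : ℝ) * T = (2 ^ d) ^ 2 * T := by
    have h2 : ∑ p ∈ Finset.range (d + 1), (d.choose p : ℝ) = 2 ^ d := by
      exact_mod_cast Nat.sum_range_choose d
    simp_rw [← Finset.sum_mul, ← Finset.mul_sum, ← Finset.sum_mul, h2]; ring
  have h4d : ((2 : ℝ) ^ d) ^ 2 ≤ 16 := by interval_cases d <;> norm_num
  calc _ ≤ ∑ p ∈ Finset.range (d + 1), ∑ q ∈ Finset.range (d + 1),
        (d.choose p : ℝ) * (d.choose q : ℝ) * T := by
        refine (Finset.abs_sum_le_sum_abs _ _).trans (Finset.sum_le_sum fun p hp => ?_)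
        rw [integral_finsetSum _ fun q hq => hint p hp q hq]
        exact (Finset.abs_sum_le_sum_abs _ _).trans (Finset.sum_le_sum fun q hq => hterm p hp q hq)
    _ ≤ 16 * T := by rw [hsum]; exact mul_le_mul_of_nonneg_right h4d hT0

end Moments

/-! ### Second moments of centred sums with affine weights. -/

section WeightedSums

variable {Ω ι : Type*} {m : ι → MeasurableSpace Ω} [mΩ : MeasurableSpace Ω] {μ : Measure Ω}
  [IsProbabilityMeasure μ]

lemma affine_fourth_moment (hle : ∀ j, m j ≤ mΩ) (hind : iIndep m μ) {ζ : ι → Ω → ℝ}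
    (hζ : ∀ j, Measurable[m j] (ζ j)) (h4 : ∀ j, MemLp (ζ j) 4 μ) (h0 : ∀ j, ∫ ω, ζ j ω ∂μ = 0)
    {K : ℝ} (hK : 1 ≤ K) (hK2 : ∀ j, ∫ ω, ζ j ω ^ 2 ∂μ ≤ K) (hK4 : ∀ j, ∫ ω, ζ j ω ^ 4 ∂μ ≤ K)
    {a : ι → ℝ} {s : Finset ι} {b L : ℝ} (hb : b ^ 2 ≤ L) (ha : ∑ j ∈ s, a j ^ 2 ≤ L) :
    MemLp (fun ω => b + ∑ j ∈ s, a j * ζ j ω) 4 μ ∧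
      ∫ ω, (b + ∑ j ∈ s, a j * ζ j ω) ^ 4 ∂μ ≤ 8 * (L ^ 2 + 3 * K ^ 2 * L ^ 2) := by
  obtain ⟨i4, -, -, iV⟩ := linear_moments hle hind hζ h4 h0 hK hK2 hK4 a s
  have hm : MemLp (fun ω => b + ∑ j ∈ s, a j * ζ j ω) 4 μ := (memLp_const b).add i4
  refine ⟨hm, ?_⟩
  have hL : (∑ j ∈ s, a j ^ 2) ^ 2 ≤ L ^ 2 :=
    pow_le_pow_left₀ (Finset.sum_nonneg fun j _ => sq_nonneg _) ha 2
  have hb4 : (b ^ 2) ^ 2 ≤ L ^ 2 := pow_le_pow_left₀ (sq_nonneg _) hb 2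
  have hi := (integrable_pow_of_memLp_four i4 le_rfl).const_mul 8
  have h1 : ∫ ω, (b + ∑ j ∈ s, a j * ζ j ω) ^ 4 ∂μ
      ≤ ∫ ω, (8 * (b ^ 2) ^ 2 + 8 * (∑ j ∈ s, a j * ζ j ω) ^ 4) ∂μ := by
    refine integral_mono (integrable_pow_of_memLp_four hm le_rfl)
      ((integrable_const _).fun_add hi) fun ω => ?_
    have := Even.add_pow_le (by decide : Even 4) (a := b) (b := ∑ j ∈ s, a j * ζ j ω)
    norm_num at this
    linarith
  rw [integral_add (integrable_const _) hi, integral_const, integral_const_mul] at h1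
  simp only [probReal_univ, one_smul] at h1
  have h2 := mul_le_mul_of_nonneg_left hL (by positivity : 0 ≤ 3 * K ^ 2)
  linarith

/-- Sums `∑ X i * (Q i) ^ d`, `d ≤ 2`, of centred `X i` with weights `Q i` that are affine in the
coordinates other than `i`, have second moments of the order of the number of summands. -/
lemma weighted_sum_second_moment [Fintype ι] [DecidableEq ι] (hle : ∀ j, m j ≤ mΩ)
    (hind : iIndep m μ) {ζ : ι → Ω → ℝ}
    (hζ : ∀ j, Measurable[m j] (ζ j)) (h4 : ∀ j, MemLp (ζ j) 4 μ) (h0 : ∀ j, ∫ ω, ζ j ω ∂μ = 0)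
    {K : ℝ} (hK : 1 ≤ K) (hK2 : ∀ j, ∫ ω, ζ j ω ^ 2 ∂μ ≤ K) (hK4 : ∀ j, ∫ ω, ζ j ω ^ 4 ∂μ ≤ K)
    {X : ι → Ω → ℝ} (hX : ∀ j, Measurable[m j] (X j)) (hX2 : ∀ j, MemLp (X j) 2 μ)
    (hX0 : ∀ j, ∫ ω, X j ω ∂μ = 0) {J : ℝ} (hXJ : ∀ j, ∫ ω, X j ω ^ 2 ∂μ ≤ J)
    (hXζ : ∀ j, ∀ q ≤ 2, Integrable (fun ω => X j ω * ζ j ω ^ q) μ)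
    (hXζJ : ∀ j, ∀ q ≤ 2, |∫ ω, X j ω * ζ j ω ^ q ∂μ| ≤ J)
    {a : ι → ι → ℝ} (ha : ∀ i, a i i = 0) {b : ι → ℝ} {L : ℝ} (hL : 1 ≤ L)
    (hb : ∀ i, b i ^ 2 ≤ L) (haL : ∀ i, ∑ j, a i j ^ 2 ≤ L) {d : ℕ} (hd : d ≤ 2) :
    MemLp (fun ω => ∑ i, X i ω * (b i + ∑ j, a i j * ζ j ω) ^ d) 2 μ ∧
      ∫ ω, (∑ i, X i ω * (b i + ∑ j, a i j * ζ j ω) ^ d) ^ 2 ∂μ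
        ≤ (J * (1 + 8 * (L ^ 2 + 3 * K ^ 2 * L ^ 2))
          + 16 * (L ^ 3 * (4 + 4 * (8 * (L ^ 2 + 3 * K ^ 2 * L ^ 2))) * J ^ 2))
          * Fintype.card ι := by
  set K' : ℝ := 8 * (L ^ 2 + 3 * K ^ 2 * L ^ 2) with hK'
  have hK'0 : 0 ≤ K' := by positivity
  set Q : ι → Ω → ℝ := fun i ω => b i + ∑ j, a i j * ζ j ω with hQ
  have hsub : ∀ i (s : Finset ι), ∑ j ∈ s, a i j ^ 2 ≤ L := fun i s =>
    (Finset.sum_le_univ_sum_of_nonneg fun j => sq_nonneg _).trans (haL i)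
  have haa : ∀ i j, |a i j| ≤ L := fun i j => by
    have h : a i j ^ 2 ≤ L := by simpa using hsub i {j}
    exact abs_le_of_sq_le_sq (h.trans (by nlinarith)) (by linarith)
  have hJ : ∀ i : ι, 0 ≤ J := fun i => (integral_nonneg fun ω => sq_nonneg _).trans (hXJ i)
  -- The zero diagonal makes `Q i` independent of `X i`.
  have hQer : ∀ i ω, Q i ω = b i + ∑ j ∈ Finset.univ.erase i, a i j * ζ j ω := fun i ω => by
    simp only [hQ]
    rw [Finset.sum_erase _ (by rw [ha i, zero_mul])]
  have hQ4 : ∀ i, MemLp (Q i) 4 μ ∧ ∫ ω, Q i ω ^ 4 ∂μ ≤ K' := fun i =>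
    affine_fourth_moment hle hind hζ h4 h0 hK hK2 hK4 (hb i) (haL i)
  have hQm : ∀ i, Measurable[⨆ j ∈ ({i}ᶜ : Set ι), m j] (Q i) := fun i => by
    rw [show Q i = _ from funext (hQer i)]
    exact (measurable_linear hζ (by simp) _).const_add _
  have hXm : ∀ i, Measurable[⨆ j ∈ ({i} : Set ι), m j] (X i) := fun i =>
    measurable_iSup_of_mem (Set.mem_singleton i) (hX i)
  have hdis : ∀ i, Disjoint ({i} : Set ι) {i}ᶜ := fun i => disjoint_compl_right
  have hdiagi : ∀ i, Integrable (fun ω => X i ω ^ 2 * Q i ω ^ (d * 2)) μ := fun i =>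
    integrable_mul_of_disjoint hle hind (hdis i) ((hXm i).pow_const 2)
      ((hQm i).pow_const (d * 2)) (hX2 i).integrable_sq
      (integrable_pow_of_memLp_four (hQ4 i).1 (by omega))
  have hmem : ∀ i, MemLp (fun ω => X i ω * Q i ω ^ d) 2 μ := fun i =>
    memLp_two_of_integrable_sq ((measurable_of_iSup hle (hXm i)).mul
      ((measurable_of_iSup hle (hQm i)).pow_const d))
      (by simpa [mul_pow, ← pow_mul] using hdiagi i)
  have hdiag : ∀ i, ∫ ω, (X i ω * Q i ω ^ d) * (X i ω * Q i ω ^ d) ∂μ ≤ J * (1 + K') := by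
    intro i
    have e : ∀ ω, (X i ω * Q i ω ^ d) * (X i ω * Q i ω ^ d) = X i ω ^ 2 * Q i ω ^ (d * 2) :=
      fun ω => by ring
    simp_rw [e]
    rw [integral_mul_of_disjoint hle hind (hdis i) ((hXm i).pow_const 2)
      ((hQm i).pow_const (d * 2))]
    have hi4 := integrable_pow_of_memLp_four (hQ4 i).1 le_rfl
    have h1 : ∫ ω, Q i ω ^ (d * 2) ∂μ ≤ ∫ ω, (1 + Q i ω ^ 4) ∂μ := by
      refine integral_mono (integrable_pow_of_memLp_four (hQ4 i).1 (by omega))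
        ((integrable_const _).fun_add hi4) fun ω => ?_
      interval_cases d
      · simpa using by positivity
      · change Q i ω ^ 2 ≤ 1 + Q i ω ^ 4
        nlinarith [sq_nonneg (Q i ω ^ 2 - 1), sq_nonneg (Q i ω ^ 2)]
      · simp
    rw [integral_add (integrable_const _) hi4] at h1
    simp only [integral_const, probReal_univ, one_smul] at h1
    exact mul_le_mul (hXJ i) (h1.trans (by linarith [(hQ4 i).2]))
      (integral_nonneg fun ω => by rw [mul_comm, pow_mul]; positivity) (hJ i)
  -- `Q i` meets observation `k` only through `a i k * ζ k`, and `Q k` meets `i` only through `a k i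
  -- * ζ i`; everything else is independent of both.
  have hoff : ∀ i k, i ≠ k → |∫ ω, (X i ω * Q i ω ^ d) * (X k ω * Q k ω ^ d) ∂μ|
      ≤ 16 * (L ^ 2 * |a i k| * |a k i| * (4 + 4 * K') * J ^ 2) := by
    intro i k hik
    set s : Finset ι := (Finset.univ.erase i).erase k with hs
    have hsm : ∀ j ∈ s, j ∈ ({i, k}ᶜ : Set ι) := fun j hj => by
      simp only [hs, Finset.mem_erase, Finset.mem_univ, and_true] at hj
      simp [hj.1, hj.2]
    have e1 : ∀ ω, Q i ω = b i + ∑ j ∈ s, a i j * ζ j ω + a i k * ζ k ω := fun ω => by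
      rw [hQer i, ← Finset.sum_erase_add _ _
        (Finset.mem_erase.2 ⟨hik.symm, Finset.mem_univ k⟩), add_assoc]
    have e2 : ∀ ω, Q k ω = b k + ∑ j ∈ s, a k j * ζ j ω + a k i * ζ i ω := fun ω => by
      rw [hQer k, hs, Finset.erase_right_comm, ← Finset.sum_erase_add _ _
        (Finset.mem_erase.2 ⟨hik, Finset.mem_univ i⟩), add_assoc]
    have hA := affine_fourth_moment hle hind hζ h4 h0 hK hK2 hK4 (hb i) (hsub i s)
    have hB := affine_fourth_moment hle hind hζ h4 h0 hK hK2 hK4 (hb k) (hsub k s)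
    have := (abs_integral_cross_le hle hind hik (hX i) (hζ i) (hX k) (hζ k)
      ((measurable_linear hζ hsm (a i)).const_add (b i))
      ((measurable_linear hζ hsm (a k)).const_add (b k)) hA.1 hB.1 hA.2 hB.2
      (hXζ i) (hXζ k) (hXζJ i) (hXζJ k) (hX0 i) (hX0 k) hd hL (haa i k) (haa k i)).2
    simp_rw [e1, e2]
    exact this
  refine ⟨memLp_finsetSum _ fun i _ => hmem i, ?_⟩
  have hint : ∀ i k, Integrable (fun ω => (X i ω * Q i ω ^ d) * (X k ω * Q k ω ^ d)) μ :=
    fun i k => (hmem i).integrable_mul (hmem k)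
  change ∫ ω, (∑ i, X i ω * Q i ω ^ d) ^ 2 ∂μ ≤ _
  simp_rw [sq (∑ i, X i _ * Q i _ ^ d), Finset.sum_mul_sum]
  rw [integral_finsetSum _ fun i _ => integrable_finsetSum _ fun k _ => hint i k]
  simp_rw [fun i => integral_finsetSum Finset.univ fun k (_ : k ∈ Finset.univ) => hint i k]
  set T : ℝ := 16 * (L ^ 2 * (4 + 4 * K') * J ^ 2) with hT
  have hT0 : 0 ≤ T := by positivity
  have hterm : ∀ i k, ∫ ω, (X i ω * Q i ω ^ d) * (X k ω * Q k ω ^ d) ∂μ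
      ≤ (if i = k then J * (1 + K') else 0) + T * ((a i k ^ 2 + a k i ^ 2) / 2) := by
    intro i k
    by_cases hik : i = k
    · subst hik
      rw [if_pos rfl]
      have : 0 ≤ T * ((a i i ^ 2 + a i i ^ 2) / 2) := by positivity
      linarith [hdiag i]
    · rw [if_neg hik, zero_add]
      refine (le_abs_self _).trans ((hoff i k hik).trans ?_)
      -- Summed over all pairs, this is the squared Frobenius norm of `a`, at most `L` times the
      -- number of rows.
      have h : |a i k| * |a k i| ≤ (a i k ^ 2 + a k i ^ 2) / 2 := by
        rw [← sq_abs (a i k), ← sq_abs (a k i)]; nlinarith [sq_nonneg (|a i k| - |a k i|)]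
      have := mul_le_mul_of_nonneg_left h hT0
      refine le_trans (le_of_eq ?_) this
      rw [hT]; ring
  have hsw : ∑ i, ∑ k, a k i ^ 2 = ∑ i, ∑ k, a i k ^ 2 := Finset.sum_comm
  have hfro : ∑ i, ∑ k, a i k ^ 2 ≤ Fintype.card ι * L := by
    simpa using Finset.sum_le_sum fun i (_ : i ∈ Finset.univ) => haL i
  calc _ ≤ ∑ i, ∑ k, ((if i = k then J * (1 + K') else 0)
        + T * ((a i k ^ 2 + a k i ^ 2) / 2)) :=
        Finset.sum_le_sum fun i _ => Finset.sum_le_sum fun k _ => hterm i k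
    _ = Fintype.card ι * (J * (1 + K')) + T * ∑ i, ∑ k, a i k ^ 2 := by
        simp_rw [Finset.sum_add_distrib, ← Finset.mul_sum, ← Finset.sum_div,
          Finset.sum_add_distrib, hsw]
        simp
    _ ≤ _ := by
        have := mul_le_mul_of_nonneg_left hfro hT0
        refine (add_le_add_right this _).trans (le_of_eq ?_)
        rw [hT]; ring

end WeightedSums

/-! ### Anti-concentration of linear forms by characteristic functions. -/

section AntiConcentration

/-- The Taylor remainder is used for `|x| ≤ 1`. Beyond that the triangle inequality suffices, since
`2 + |x| + x² / 2 ≤ 4 |x|³`; so no truncation of the variable is needed later. -/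
lemma norm_exp_mul_I_sub_taylor_le (x : ℝ) :
    ‖Complex.exp (x * Complex.I) - (1 + x * Complex.I - x ^ 2 / 2)‖ ≤ 4 * |x| ^ 3 := by
  have hn : ‖(x : ℂ) * Complex.I‖ = |x| := by simp
  rcases le_or_gt |x| 1 with hx | hx
  · have h := Complex.exp_bound (x := x * Complex.I) (hn.trans_le hx) (n := 3) (by norm_num)
    rw [hn] at h
    have e : ∑ k ∈ Finset.range 3, ((x : ℂ) * Complex.I) ^ k / (k.factorial : ℂ)
        = 1 + x * Complex.I - x ^ 2 / 2 := by
      simp only [Finset.sum_range_succ, Finset.sum_range_zero, Nat.factorial, mul_pow,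
        Complex.I_sq]
      push_cast; ring
    rw [e] at h
    refine h.trans ?_
    rw [mul_comm]
    refine mul_le_mul_of_nonneg_right ?_ (by positivity)
    norm_num [Nat.factorial]
  · have h1 : ‖(1 + x * Complex.I - x ^ 2 / 2 : ℂ)‖ ≤ 1 + |x| + x ^ 2 / 2 := by
      refine (norm_sub_le _ _).trans (add_le_add ((norm_add_le _ _).trans ?_) ?_)
      · rw [hn]; simp
      · simp
    refine (norm_sub_le _ _).trans ?_
    rw [Complex.norm_exp_ofReal_mul_I]
    have hx2 : x ^ 2 = |x| ^ 2 := (sq_abs x).symm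
    nlinarith [mul_pos (sub_pos.2 hx) (sub_pos.2 hx), pow_le_pow_right₀ hx.le (by norm_num : 2 ≤ 3),
      pow_le_pow_right₀ hx.le (by norm_num : 1 ≤ 3)]

variable {Ω : Type*} [MeasurableSpace Ω] {μ : Measure Ω} [IsProbabilityMeasure μ]

/-- Near the origin the characteristic function of a centred variable with nondegenerate variance
and bounded third moment is dominated by a Gaussian one. -/
lemma norm_charFun_le_exp {Y : Ω → ℝ} (hY : Measurable Y) (h4 : MemLp Y 4 μ)
    (h0 : ∫ ω, Y ω ∂μ = 0) {c : ℝ} (hc : 1 < c) (hlow : c⁻¹ ≤ ∫ ω, Y ω ^ 2 ∂μ)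
    (hup : ∫ ω, Y ω ^ 2 ∂μ ≤ c) (h3 : ∫ ω, |Y ω| ^ 3 ∂μ ≤ c) {s : ℝ}
    (hs : |s| ≤ (16 * c ^ 2)⁻¹) :
    ‖charFun (μ.map Y) s‖ ≤ Real.exp (-(s ^ 2 / (4 * c))) := by
  set V : ℝ := ∫ ω, Y ω ^ 2 ∂μ with hV
  have hc0 : 0 < c := by linarith
  rw [charFun_apply_real, integral_map hY.aemeasurable (by fun_prop)]
  have hi1 : Integrable Y μ := by simpa using integrable_pow_of_memLp_four h4 (k := 1)
  have hi2 := integrable_pow_of_memLp_four h4 (k := 2) (by norm_num)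
  have hi3 : Integrable (fun ω => |Y ω| ^ 3) μ := by
    simpa [abs_pow] using (integrable_pow_of_memLp_four h4 (k := 3) (by norm_num)).abs
  have hexpi : Integrable (fun ω => Complex.exp (s * Y ω * Complex.I)) μ := by
    refine (integrable_const (1 : ℝ)).mono' (by fun_prop) (.of_forall fun ω => ?_)
    rw [← Complex.ofReal_mul, Complex.norm_exp_ofReal_mul_I]
  set p : Ω → ℂ := fun ω => 1 + (s : ℂ) * Complex.I * (Y ω : ℂ) - (s : ℂ) ^ 2 / 2 * ((Y ω ^ 2 : ℝ) : ℂ)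
    with hp
  have hp1 : Integrable (fun ω => (1 : ℂ) + (s : ℂ) * Complex.I * (Y ω : ℂ)) μ :=
    (integrable_const _).add (hi1.ofReal.const_mul _)
  have hp2 : Integrable (fun ω => (s : ℂ) ^ 2 / 2 * ((Y ω ^ 2 : ℝ) : ℂ)) μ :=
    hi2.ofReal.const_mul _
  have hpi : Integrable p μ := hp1.sub hp2
  have hpE : ∫ ω, p ω ∂μ = ((1 - s ^ 2 * V / 2 : ℝ) : ℂ) := by
    simp only [hp]
    rw [integral_sub hp1 hp2, integral_add (integrable_const _) (hi1.ofReal.const_mul _),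
      integral_const_mul, integral_const_mul, integral_complex_ofReal, integral_complex_ofReal, h0]
    simp [← hV]; ring
  have hdiff : ‖∫ ω, Complex.exp (s * Y ω * Complex.I) ∂μ - ∫ ω, p ω ∂μ‖ ≤ 4 * |s| ^ 3 * c := by
    rw [← integral_sub hexpi hpi]
    have : ∀ ω, ‖Complex.exp (s * Y ω * Complex.I) - p ω‖ ≤ 4 * |s| ^ 3 * |Y ω| ^ 3 := fun ω => by
      have h := norm_exp_mul_I_sub_taylor_le (s * Y ω)
      rw [abs_mul, mul_pow, ← mul_assoc] at h
      refine le_trans (le_of_eq ?_) h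
      simp only [hp]; push_cast; congr 1; ring
    refine (norm_integral_le_of_norm_le (hi3.const_mul _) (.of_forall this)).trans ?_
    rw [integral_const_mul]
    exact mul_le_mul_of_nonneg_left h3 (by positivity)
  have hs1 : |s| * (16 * c ^ 2) ≤ 1 := by
    rwa [← le_div_iff₀ (by positivity), one_div]
  have hs2 : |s| ≤ 1 := by nlinarith [abs_nonneg s]
  -- Ensures that the Taylor polynomial of the characteristic function, `1 - s² V / 2`, is
  -- nonnegative and equals its own norm.
  have hV1 : s ^ 2 * V ≤ 1 := by
    rw [← sq_abs]
    have : |s| * V ≤ 1 :=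
      (mul_le_mul_of_nonneg_left (hup.trans (by nlinarith)) (abs_nonneg s)).trans hs1
    nlinarith [abs_nonneg s, mul_le_mul_of_nonneg_left this (abs_nonneg s)]
  have hpn : ‖∫ ω, p ω ∂μ‖ ≤ 1 - s ^ 2 / (2 * c) := by
    rw [hpE, Complex.norm_real, Real.norm_eq_abs, abs_of_nonneg (by linarith)]
    have := mul_le_mul_of_nonneg_left hlow (sq_nonneg s)
    have e : s ^ 2 / (2 * c) = s ^ 2 * c⁻¹ / 2 := by field_simp
    rw [e]; linarith
  -- The range `|s| ≤ (16 c²)⁻¹` is what lets the cubic remainder consume only half of the quadratic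
  -- gain `s² / (2 c)`.
  have h3' : 4 * |s| ^ 3 * c ≤ s ^ 2 / (4 * c) := by
    rw [le_div_iff₀ (by positivity), ← sq_abs]
    have := mul_le_mul_of_nonneg_left hs1 (sq_nonneg |s|)
    nlinarith
  have h5 : s ^ 2 / (2 * c) = s ^ 2 / (4 * c) + s ^ 2 / (4 * c) := by field_simp; ring
  have h6 := Real.add_one_le_exp (-(s ^ 2 / (4 * c)))
  have h7 := norm_le_norm_add_norm_sub' (∫ ω, Complex.exp (s * Y ω * Complex.I) ∂μ) (∫ ω, p ω ∂μ)
  linarith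

/-- Gaussian smoothing: the mass of an interval is controlled by the characteristic function. -/
lemma measureReal_abs_le_le_integral_charFun {T : Ω → ℝ} (hT : Measurable T) (t : ℝ) {r : ℝ}
    (hr : 0 < r) :
    μ.real {ω | |t + T ω| ≤ r}
      ≤ 2 * ∫ g, ‖charFun (μ.map T) (g / r)‖ ∂(gaussianReal 0 1) := by
  set γ := gaussianReal 0 1 with hγ
  set f : Ω → ℝ → ℂ := fun ω g => Complex.exp ((((t + T ω) / r * g : ℝ) : ℂ) * Complex.I) with hf
  have hfn : ∀ ω g, ‖f ω g‖ = 1 := fun ω g => Complex.norm_exp_ofReal_mul_I _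
  have hfi : Integrable (Function.uncurry f) (μ.prod γ) := by
    refine (integrable_const (1 : ℝ)).mono' ?_ (.of_forall fun z => (hfn z.1 z.2).le)
    simp only [hf, Function.uncurry_def]
    exact Measurable.aestronglyMeasurable (by fun_prop)
  -- The Gaussian kernel is itself the characteristic function of `γ`, so Fubini turns its
  -- expectation into an average of the characteristic function of `T`.
  have hin : ∀ ω, ∫ g, f ω g ∂γ = ((Real.exp (-((t + T ω) / r) ^ 2 / 2) : ℝ) : ℂ) := fun ω => by
    have := charFun_gaussianReal (μ := 0) (v := 1) ((t + T ω) / r)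
    rw [charFun_apply_real] at this
    simp only [hf, Complex.ofReal_mul, hγ]
    rw [this]; push_cast; congr 1; ring
  -- The shift `t` contributes only a phase, hence the bound is uniform in `t`.
  have hout : ∀ g, ‖∫ ω, f ω g ∂μ‖ = ‖charFun (μ.map T) (g / r)‖ := fun g => by
    rw [charFun_apply_real, integral_map hT.aemeasurable (by fun_prop)]
    have e : ∀ ω, f ω g = Complex.exp (((t * (g / r) : ℝ) : ℂ) * Complex.I)
        * Complex.exp (((g / r : ℝ) : ℂ) * T ω * Complex.I) := fun ω => by
      simp only [hf]; rw [← Complex.exp_add]; congr 1; push_cast; ring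
    simp_rw [e]
    rw [integral_const_mul, norm_mul, Complex.norm_exp_ofReal_mul_I, one_mul]
  have hsmall : Integrable (fun ω => Real.exp (-((t + T ω) / r) ^ 2 / 2)) μ := by
    refine (integrable_const (1 : ℝ)).mono' (Measurable.aestronglyMeasurable (by fun_prop))
      (.of_forall fun ω => ?_)
    rw [Real.norm_of_nonneg (Real.exp_pos _).le, Real.exp_le_one_iff]
    nlinarith [sq_nonneg ((t + T ω) / r)]
  have h1 : ∫ ω, Real.exp (-((t + T ω) / r) ^ 2 / 2) ∂μ
      ≤ ∫ g, ‖charFun (μ.map T) (g / r)‖ ∂γ := by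
    have e : ((∫ ω, Real.exp (-((t + T ω) / r) ^ 2 / 2) ∂μ : ℝ) : ℂ)
        = ∫ g, ∫ ω, f ω g ∂μ ∂γ := by
      rw [← integral_integral_swap hfi]
      simp_rw [hin]
      exact integral_complex_ofReal.symm
    have h2 : ‖((∫ ω, Real.exp (-((t + T ω) / r) ^ 2 / 2) ∂μ : ℝ) : ℂ)‖
        ≤ ∫ g, ‖charFun (μ.map T) (g / r)‖ ∂γ := by
      rw [e]
      refine (norm_integral_le_integral_norm _).trans (le_of_eq ?_)
      simp_rw [hout]
    rw [Complex.norm_real] at h2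
    exact (le_abs_self _).trans h2
  -- Markov's inequality at level `1 / 2`, which is below the kernel value `exp (-1 / 2)` at
  -- distance `r`.
  have h2 : (1 / 2 : ℝ) * μ.real {ω | (1 / 2 : ℝ) ≤ Real.exp (-((t + T ω) / r) ^ 2 / 2)}
      ≤ ∫ ω, Real.exp (-((t + T ω) / r) ^ 2 / 2) ∂μ :=
    mul_meas_ge_le_integral_of_nonneg (.of_forall fun ω => (Real.exp_pos _).le) hsmall _
  have h3 : μ.real {ω | |t + T ω| ≤ r}
      ≤ μ.real {ω | (1 / 2 : ℝ) ≤ Real.exp (-((t + T ω) / r) ^ 2 / 2)} := by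
    refine measureReal_mono fun ω hω => ?_
    simp only [Set.mem_ofPred_eq] at hω ⊢
    have h4 : ((t + T ω) / r) ^ 2 ≤ 1 := by
      rw [div_pow, div_le_one (by positivity), ← sq_abs]
      exact pow_le_pow_left₀ (abs_nonneg _) hω 2
    have := Real.add_one_le_exp (-((t + T ω) / r) ^ 2 / 2)
    linarith
  linarith

/-- Anti-concentration of a linear combination of independent variables whose coefficients are
individually small but not jointly. -/
lemma measureReal_abs_linear_le {ι : Type*} [Fintype ι] {ζ : ι → Ω → ℝ} (hind : iIndepFun ζ μ)
    (hζ : ∀ j, Measurable (ζ j)) (h4 : ∀ j, MemLp (ζ j) 4 μ) (h0 : ∀ j, ∫ ω, ζ j ω ∂μ = 0)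
    {c : ℝ} (hc : 1 < c) (hlow : ∀ j, c⁻¹ ≤ ∫ ω, ζ j ω ^ 2 ∂μ)
    (hup : ∀ j, ∫ ω, ζ j ω ^ 2 ∂μ ≤ c) (h3 : ∀ j, ∫ ω, |ζ j ω| ^ 3 ∂μ ≤ c)
    {w : ι → ℝ} {δ κ : ℝ} (hδ : 0 < δ) (hκ : 0 < κ) (hw : ∀ j, |w j| ≤ δ)
    (hwκ : κ ≤ ∑ j, w j ^ 2) (t : ℝ) {r : ℝ} (hr : 0 < r) :
    μ.real {ω | |t + ∑ j, w j * ζ j ω| ≤ r}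
      ≤ 2 * (r * √(4 * Real.pi * c / κ) + (16 * c ^ 2 * δ / r) ^ 2) := by
  have hc0 : 0 < c := by linarith
  have hTm : Measurable (fun ω => ∑ j, w j * ζ j ω) := by fun_prop
  set φ := charFun (μ.map fun ω => ∑ j, w j * ζ j ω) with hφ
  have : IsProbabilityMeasure (μ.map fun ω => ∑ j, w j * ζ j ω) :=
    Measure.isProbabilityMeasure_map hTm.aemeasurable
  have hprod : ∀ x, φ x = ∏ j, charFun (μ.map (ζ j)) (w j * x) := fun x => by
    have hi : iIndepFun (fun j ω => w j * ζ j ω) μ :=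
      hind.comp (fun j y => w j * y) fun j => measurable_const_mul (w j)
    rw [hφ, hi.charFun_map_fun_sum_eq_prod fun j => ((hζ j).const_mul _).aemeasurable,
      Finset.prod_apply]
    refine Finset.prod_congr rfl fun j _ => ?_
    rw [charFun_map_mul_comp (hζ j).aemeasurable]
  have hb1 : ∀ x, |x| * δ ≤ (16 * c ^ 2)⁻¹ → ‖φ x‖ ≤ Real.exp (-(κ / (4 * c) * x ^ 2)) := by
    intro x hx
    rw [hprod, norm_prod]
    calc ∏ j, ‖charFun (μ.map (ζ j)) (w j * x)‖
        ≤ ∏ j, Real.exp (-((w j * x) ^ 2 / (4 * c))) := by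
          refine Finset.prod_le_prod (fun j _ => norm_nonneg _) fun j _ =>
            norm_charFun_le_exp (hζ j) (h4 j) (h0 j) hc (hlow j) (hup j) (h3 j) ?_
          rw [abs_mul, mul_comm]
          exact (mul_le_mul_of_nonneg_left (hw j) (abs_nonneg x)).trans hx
      _ = Real.exp (-((∑ j, w j ^ 2) / (4 * c) * x ^ 2)) := by
          rw [← Real.exp_sum, Finset.sum_neg_distrib, Finset.sum_div, Finset.sum_mul]
          congr 2
          exact Finset.sum_congr rfl fun j _ => by ring
      _ ≤ _ := by
          rw [Real.exp_le_exp, neg_le_neg_iff]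
          gcongr
  set b : ℝ := κ / (4 * c * r ^ 2) with hb
  have hb0 : 0 < b := by positivity
  -- At frequencies too large for the Gaussian bound, the trivial bound `1` is dominated by the
  -- quadratic term, as in Chebyshev's inequality; that term has a finite Gaussian integral.
  have hpt : ∀ g, ‖φ (g / r)‖ ≤ Real.exp (-b * g ^ 2) + (16 * c ^ 2 * δ / r) ^ 2 * g ^ 2 := by
    intro g
    rcases le_or_gt (|g / r| * δ) (16 * c ^ 2)⁻¹ with h | h
    · have h1 := hb1 _ h
      have e : κ / (4 * c) * (g / r) ^ 2 = b * g ^ 2 := by rw [hb]; field_simp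
      rw [e, ← neg_mul] at h1
      have : 0 ≤ (16 * c ^ 2 * δ / r) ^ 2 * g ^ 2 := by positivity
      linarith
    · have h1 : 1 ≤ (16 * c ^ 2 * δ / r) ^ 2 * g ^ 2 := by
        rw [inv_lt_iff_one_lt_mul₀ (by positivity)] at h
        have e : (16 * c ^ 2 * δ / r) ^ 2 * g ^ 2 = (16 * c ^ 2 * (|g / r| * δ)) ^ 2 := by
          rw [mul_pow, mul_pow |g / r|, sq_abs]; ring
        rw [e, mul_comm]
        exact one_le_pow₀ h.le
      have := norm_charFun_le_one (μ := μ.map fun ω => ∑ j, w j * ζ j ω) (g / r)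
      exact this.trans (by linarith [Real.exp_pos (-b * g ^ 2)])
  have hgi : Integrable (fun g : ℝ => g ^ 2) (gaussianReal 0 1) :=
    (memLp_id_gaussianReal 2).integrable_sq
  have hgE : ∫ g, g ^ 2 ∂(gaussianReal 0 1) = 1 := by
    have h := variance_fun_id_gaussianReal (μ := 0) (v := 1)
    rw [variance_of_integral_eq_zero aemeasurable_id' integral_id_gaussianReal] at h
    simpa using h
  have hei : Integrable (fun g : ℝ => Real.exp (-b * g ^ 2)) (gaussianReal 0 1) := by
    refine (integrable_const (1 : ℝ)).mono' (Measurable.aestronglyMeasurable (by fun_prop))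
      (.of_forall fun g => ?_)
    rw [Real.norm_of_nonneg (Real.exp_pos _).le, Real.exp_le_one_iff]
    nlinarith [sq_nonneg g]
  -- The standard normal density is at most `1`, so the Lebesgue integral is an upper bound.
  have heE : ∫ g, Real.exp (-b * g ^ 2) ∂(gaussianReal 0 1) ≤ √(Real.pi / b) := by
    rw [integral_gaussianReal_eq_integral_smul one_ne_zero, ← integral_gaussian]
    refine integral_mono_of_nonneg (.of_forall fun g => smul_nonneg (gaussianPDFReal_nonneg _ _ _)
      (Real.exp_pos _).le) (integrable_exp_neg_mul_sq hb0) (.of_forall fun g => ?_)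
    have h1 : gaussianPDFReal 0 1 g ≤ 1 := by
      rw [gaussianPDFReal]
      refine mul_le_one₀ ?_ (Real.exp_pos _).le ?_
      · refine inv_le_one_of_one_le₀ (Real.one_le_sqrt.2 ?_)
        simp only [NNReal.coe_one, mul_one]
        nlinarith [Real.pi_gt_three]
      · rw [Real.exp_le_one_iff]
        simp only [NNReal.coe_one, mul_one]
        nlinarith [sq_nonneg (g - 0)]
    simpa using mul_le_mul_of_nonneg_right h1 (Real.exp_pos (-(b * g ^ 2))).le
  refine (measureReal_abs_le_le_integral_charFun hTm t hr).trans
    (mul_le_mul_of_nonneg_left ?_ zero_le_two)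
  calc ∫ g, ‖φ (g / r)‖ ∂(gaussianReal 0 1)
      ≤ ∫ g, (Real.exp (-b * g ^ 2) + (16 * c ^ 2 * δ / r) ^ 2 * g ^ 2) ∂(gaussianReal 0 1) :=
        integral_mono_of_nonneg (.of_forall fun g => norm_nonneg _)
          (hei.fun_add (hgi.const_mul _)) (.of_forall hpt)
    _ ≤ _ := by
        rw [integral_add hei (hgi.const_mul _), integral_const_mul, hgE, mul_one]
        refine add_le_add_left (heE.trans (le_of_eq ?_)) _
        have e : Real.pi / b = r ^ 2 * (4 * Real.pi * c / κ) := by rw [hb]; field_simp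
        rw [e, Real.sqrt_mul (sq_nonneg r), Real.sqrt_sq hr.le]

end AntiConcentration

/-! ### Small-ball estimates for `|b + a ζ|²`: the diffuse and the concentrated case. -/

section SmallBall

variable {Ω : Type*} [mΩ : MeasurableSpace Ω] {μ : Measure Ω} [IsProbabilityMeasure μ] {n : ℕ}

/-- If no direction carries a share `κ n` of the matrix `a`, the squared length of
`b + a ζ` concentrates around its mean. -/
lemma measureReal_sum_sq_le_of_forall {m : Fin n → MeasurableSpace Ω} (hle : ∀ j, m j ≤ mΩ)
    (hind : iIndep m μ) {ζ : Fin n → Ω → ℝ}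
    (hζ : ∀ j, Measurable[m j] (ζ j)) (h4 : ∀ j, MemLp (ζ j) 4 μ) (h0 : ∀ j, ∫ ω, ζ j ω ∂μ = 0)
    {c : ℝ} (hc : 1 < c) (hc2 : ∀ j, ∫ ω, ζ j ω ^ 2 ∂μ ≤ c) (hc4 : ∀ j, ∫ ω, ζ j ω ^ 4 ∂μ ≤ c)
    (hn : 0 < n) {a : Fin n → Fin n → ℝ} (hcol : ∀ j, ∑ i, a i j ^ 2 ≤ c) {b : Fin n → ℝ}
    (hb : ∀ i, b i ^ 2 ≤ 1) (hE : n * c⁻¹ ≤ ∫ ω, ∑ i, (b i + ∑ j, a i j * ζ j ω) ^ 2 ∂μ)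
    {κ : ℝ} (hκ : 0 < κ)
    (hspec : ∀ u : Fin n → ℝ, ∑ j, (∑ i, u i * a i j) ^ 2 ≤ κ * n * ∑ i, u i ^ 2) :
    μ.real {ω | ∑ i, (b i + ∑ j, a i j * ζ j ω) ^ 2 ≤ n / (2 * c)}
      ≤ 64 * c ^ 4 * (c ^ 2 / n + κ * (1 + c)) := by
  have hc0 : 0 < c := by linarith
  have hn0 : (0 : ℝ) < n := by exact_mod_cast hn
  -- `B = aᵀ a` and `d = aᵀ b` are the quadratic and linear coefficients of `|b + a ζ|²`, whose mean
  -- is `e` below.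
  set B : Fin n → Fin n → ℝ := fun j k => ∑ i, a i j * a i k with hB
  set d : Fin n → ℝ := fun j => ∑ i, b i * a i j with hd
  obtain ⟨F2, F0, FV⟩ := quadratic_second_moment hle hind hζ h4 h0 hc.le hc2 hc4 B
    (fun j k => Finset.sum_congr rfl fun i _ => mul_comm _ _) d Finset.univ
  set F : Ω → ℝ := fun ω => ∑ j, ∑ k, B j k * (ζ j ω * ζ k ω) + 2 * ∑ j, d j * ζ j ω
        - ∑ j, B j j * ∫ ω, ζ j ω ^ 2 ∂μ with hF
  set e : ℝ := ∑ i, b i ^ 2 + ∑ j, B j j * ∫ ω, ζ j ω ^ 2 ∂μ with he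
  have hS : ∀ ω, ∑ i, (b i + ∑ j, a i j * ζ j ω) ^ 2 = e + F ω := by
    intro ω
    have h1 : ∑ j, ∑ k, B j k * (ζ j ω * ζ k ω) = ∑ i, (∑ j, a i j * ζ j ω) ^ 2 := by
      simp_rw [hB, sq, Finset.sum_mul_sum, Finset.sum_mul]
      rw [Finset.sum_congr rfl fun j _ => Finset.sum_comm, Finset.sum_comm]
      exact Finset.sum_congr rfl fun i _ => Finset.sum_congr rfl fun j _ =>
        Finset.sum_congr rfl fun k _ => by ring
    have h2 : ∑ j, d j * ζ j ω = ∑ i, b i * ∑ j, a i j * ζ j ω := by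
      simp_rw [hd, Finset.sum_mul, Finset.mul_sum]
      rw [Finset.sum_comm]
      exact Finset.sum_congr rfl fun i _ => Finset.sum_congr rfl fun j _ => by ring
    simp only [hF, he]
    rw [h1, h2]
    simp_rw [add_sq, Finset.sum_add_distrib, mul_assoc, ← Finset.mul_sum]
    ring
  have hEe : ∫ ω, ∑ i, (b i + ∑ j, a i j * ζ j ω) ^ 2 ∂μ = e := by
    simp_rw [hS]
    rw [integral_add (integrable_const _) (F2.integrable (by norm_num)), F0]
    simp
  rw [hEe] at hE
  have hBjj : ∀ j, B j j = ∑ i, a i j ^ 2 := fun j =>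
    Finset.sum_congr rfl fun i _ => (sq _).symm
  have hs1 : ∑ j, B j j ^ 2 ≤ n * c ^ 2 := by
    have : ∀ j ∈ (Finset.univ : Finset (Fin n)), B j j ^ 2 ≤ c ^ 2 := fun j _ => by
      rw [hBjj]
      exact pow_le_pow_left₀ (Finset.sum_nonneg fun i _ => sq_nonneg _) (hcol j) 2
    simpa using Finset.sum_le_sum this
  -- The spectral bound is used at `u = b` for the linear part, and in `hs3` at the columns of `a`,
  -- whose images under `aᵀ` are the rows of `B`.
  have hs2 : ∑ j, d j ^ 2 ≤ κ * n * n := by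
    refine (hspec b).trans (mul_le_mul_of_nonneg_left ?_ (by positivity))
    simpa using Finset.sum_le_sum fun i (_ : i ∈ Finset.univ) => hb i
  have hs3 : ∑ j, ∑ k, B j k ^ 2 ≤ n * (κ * n * c) := by
    have : ∀ j ∈ (Finset.univ : Finset (Fin n)), ∑ k, B j k ^ 2 ≤ κ * n * c := fun j _ =>
      (hspec fun i => a i j).trans (mul_le_mul_of_nonneg_left (hcol j) (by positivity))
    simpa using Finset.sum_le_sum this
  have hFV : ∫ ω, F ω ^ 2 ∂μ ≤ 16 * c ^ 2 * (n * c ^ 2 + κ * n * n + n * (κ * n * c)) := by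
    refine FV.trans (mul_le_mul_of_nonneg_left ?_ (by positivity))
    simp_rw [Finset.sum_add_distrib]
    linarith
  have hmk := mul_meas_ge_le_integral_of_nonneg (μ := μ) (f := fun ω => F ω ^ 2)
    (.of_forall fun ω => sq_nonneg _) F2.integrable_sq ((n / (2 * c)) ^ 2)
  have hsub : μ.real {ω | ∑ i, (b i + ∑ j, a i j * ζ j ω) ^ 2 ≤ n / (2 * c)}
      ≤ μ.real {ω | (n / (2 * c)) ^ 2 ≤ F ω ^ 2} := by
    refine measureReal_mono fun ω hω => ?_
    simp only [Set.mem_ofPred_eq] at hω ⊢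
    -- The mean is at least `n / c`, so falling below `n / (2 c)` is a deviation of at least `n / (2
    -- c)`.
    rw [hS] at hω
    have h1 : (n : ℝ) * c⁻¹ = n / (2 * c) + n / (2 * c) := by field_simp; ring
    have h2 : n / (2 * c) ≤ -F ω := by linarith
    rw [← neg_sq (F ω)]
    exact pow_le_pow_left₀ (by positivity) h2 2
  have h3 := (mul_le_mul_of_nonneg_left hsub (sq_nonneg (n / (2 * c)))).trans (hmk.trans hFV)
  refine le_of_mul_le_mul_left (h3.trans (le_of_eq ?_))
    (by positivity : 0 < ((n : ℝ) / (2 * c)) ^ 2)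
  field_simp
  ring

/-- If some direction carries a share `κ n` of the matrix `a`, the projection of `b + a ζ` on it
is anti-concentrated. -/
lemma measureReal_sum_sq_le_of_exists {ζ : Fin n → Ω → ℝ} (hind : iIndepFun ζ μ)
    (hζ : ∀ j, Measurable (ζ j)) (h4 : ∀ j, MemLp (ζ j) 4 μ) (h0 : ∀ j, ∫ ω, ζ j ω ∂μ = 0)
    {c : ℝ} (hc : 1 < c) (hlow : ∀ j, c⁻¹ ≤ ∫ ω, ζ j ω ^ 2 ∂μ)
    (hup : ∀ j, ∫ ω, ζ j ω ^ 2 ∂μ ≤ c) (h3 : ∀ j, ∫ ω, |ζ j ω| ^ 3 ∂μ ≤ c)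
    (hn : 0 < n) {a : Fin n → Fin n → ℝ} (hcol : ∀ j, ∑ i, a i j ^ 2 ≤ c) (b : Fin n → ℝ)
    {κ : ℝ} (hκ : 0 < κ) {u : Fin n → ℝ}
    (hu : κ * n * ∑ i, u i ^ 2 < ∑ j, (∑ i, u i * a i j) ^ 2) {r : ℝ} (hr : 0 < r) :
    μ.real {ω | ∑ i, (b i + ∑ j, a i j * ζ j ω) ^ 2 ≤ r ^ 2 * n}
      ≤ 2 * (r * √(4 * Real.pi * c / κ) + (16 * c ^ 2 * √(c / n) / r) ^ 2) := by
  have hc0 : 0 < c := by linarith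
  have hn0 : (0 : ℝ) < n := by exact_mod_cast hn
  set U : ℝ := ∑ i, u i ^ 2 with hU
  have hcs : ∀ x : Fin n → ℝ, (∑ i, u i * x i) ^ 2 ≤ U * ∑ i, x i ^ 2 := fun x =>
    Finset.sum_mul_sq_le_sq_mul_sq _ _ _
  have hU0 : 0 < U := by
    refine lt_of_le_of_ne (Finset.sum_nonneg fun i _ => sq_nonneg _) fun h => ?_
    have : ∑ j, (∑ i, u i * a i j) ^ 2 ≤ 0 :=
      Finset.sum_nonpos fun j _ => (hcs fun i => a i j).trans (by rw [← h, zero_mul])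
    rw [← h, mul_zero] at hu
    linarith
  -- With this normalization Cauchy–Schwarz does double duty: the coefficients of the projection are
  -- at most `√(c / n)` by the column bound, and the squared projection is at most `|b + a ζ|² / n`.
  set ν : ℝ := √(U * n) with hν
  have hν0 : 0 < ν := Real.sqrt_pos.2 (by positivity)
  have hν2 : ν ^ 2 = U * n := Real.sq_sqrt (by positivity)
  have hw : ∀ j, |(∑ i, u i * a i j) / ν| ≤ √(c / n) := fun j => by
    refine Real.abs_le_sqrt ?_
    rw [div_pow, hν2, div_le_div_iff₀ (by positivity) hn0]
    have := (hcs fun i => a i j).trans (mul_le_mul_of_nonneg_left (hcol j) hU0.le)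
    nlinarith [mul_le_mul_of_nonneg_right this hn0.le]
  have hwκ : κ ≤ ∑ j, ((∑ i, u i * a i j) / ν) ^ 2 := by
    simp_rw [div_pow]
    rw [← Finset.sum_div, hν2, le_div_iff₀ (by positivity)]
    linarith
  refine le_trans (measureReal_mono fun ω hω => ?_)
    (measureReal_abs_linear_le hind hζ h4 h0 hc hlow hup h3
    (Real.sqrt_pos.2 (by positivity)) hκ hw hwκ ((∑ i, u i * b i) / ν) hr)
  simp only [Set.mem_ofPred_eq] at hω ⊢
  have h1 : (∑ i, u i * b i) / ν + ∑ j, (∑ i, u i * a i j) / ν * ζ j ω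
      = (∑ i, u i * (b i + ∑ j, a i j * ζ j ω)) / ν := by
    have h2 : ∑ j, (∑ i, u i * a i j) * ζ j ω = ∑ i, u i * ∑ j, a i j * ζ j ω := by
      simp_rw [Finset.sum_mul, Finset.mul_sum]
      rw [Finset.sum_comm]
      exact Finset.sum_congr rfl fun i _ => Finset.sum_congr rfl fun j _ => by ring
    simp_rw [div_mul_eq_mul_div, ← Finset.sum_div, h2, mul_add, Finset.sum_add_distrib]
    ring
  rw [h1]
  refine abs_le_of_sq_le_sq ?_ hr.le
  rw [div_pow, hν2, div_le_iff₀ (by positivity)]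
  have := (hcs fun i => b i + ∑ j, a i j * ζ j ω).trans (mul_le_mul_of_nonneg_left hω hU0.le)
  linarith

end SmallBall

end JackknifeIV

/-! ### Reduction of the IV model to independent centred errors and scaled weights. -/

noncomputable section

namespace JackknifeIV

lemma memLp_four_of_integrable {Ω : Type*} [MeasurableSpace Ω] {μ : Measure Ω} {f : Ω → ℝ}
    (hf : Measurable f) (h : Integrable (fun ω => |f ω| ^ 4) μ) : MemLp f 4 μ := by
  rw [← integrable_norm_rpow_iff hf.aestronglyMeasurable (by norm_num) (by norm_num)]
  refine h.congr (.of_forall fun ω => ?_)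
  rw [show (4 : ENNReal).toReal = ((4 : ℕ) : ℝ) by norm_num]
  exact (Real.rpow_natCast _ 4).symm

namespace IVModel

variable {n : ℕ} {Ω : Type*} [mΩ : MeasurableSpace Ω] {μ : Measure Ω} {M : IVModel n μ}
  {H : Matrix (Fin n) (Fin n) ℝ} {β₀ c : ℝ}

/-- The σ-algebra generated by the errors of observation `i`. -/
@[reducible]
def obsSigma (M : IVModel n μ) (i : Fin n) : MeasurableSpace Ω :=
  MeasurableSpace.comap (fun ω => (M.ε i ω, M.v i ω)) inferInstance

/-- The scaled weights of the first-stage estimate. -/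
def weight (M : IVModel n μ) (H : Matrix (Fin n) (Fin n) ℝ) (β₀ : ℝ) (i j : Fin n) : ℝ :=
  M.scale H β₀ * H i j

/-- The mean of the scaled infeasible first-stage estimate. -/
def shift (M : IVModel n μ) (H : Matrix (Fin n) (Fin n) ℝ) (β₀ : ℝ) (i : Fin n) : ℝ :=
  M.scale H β₀ * ∑ j, H i j * (M.firstStage j * (1 - M.ρ β₀ j * (M.β - β₀)))

lemma obsSigma_le (M : IVModel n μ) (i : Fin n) : M.obsSigma i ≤ mΩ :=
  ((M.measurable_ε i).prodMk (M.measurable_v i)).comap_le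

lemma iIndep_obsSigma (M : IVModel n μ) : iIndep M.obsSigma μ :=
  (iIndepFun_iff_iIndep _ _ _).1 M.indep

lemma measurable_pair_obsSigma (M : IVModel n μ) (i : Fin n) :
    Measurable[M.obsSigma i] (fun ω => (M.ε i ω, M.v i ω)) :=
  comap_measurable _

lemma measurable_η (M : IVModel n μ) (β₀ : ℝ) (i : Fin n) :
    Measurable[M.obsSigma i] (M.η β₀ i) := by
  have h : Measurable (fun p : ℝ × ℝ => (M.β - β₀) * p.2 + p.1) := by fun_prop
  exact h.comp (M.measurable_pair_obsSigma i)

lemma measurable_ζ (M : IVModel n μ) (β₀ : ℝ) (i : Fin n) :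
    Measurable[M.obsSigma i] (M.ζ β₀ i) := by
  have h : Measurable (fun p : ℝ × ℝ => p.2 - M.ρ β₀ i * ((M.β - β₀) * p.2 + p.1)) := by fun_prop
  exact h.comp (M.measurable_pair_obsSigma i)

lemma iIndepFun_ζ (M : IVModel n μ) (β₀ : ℝ) : iIndepFun (M.ζ β₀) μ :=
  M.indep.comp (fun i p => p.2 - M.ρ β₀ i * ((M.β - β₀) * p.2 + p.1)) fun i => by fun_prop

lemma nullError_eq (M : IVModel n μ) (β₀ : ℝ) (i : Fin n) (ω : Ω) :
    M.nullError β₀ i ω = M.firstStage i * (M.β - β₀) + M.η β₀ i ω := by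
  simp only [nullError, y, x, η]; ring

lemma r_eq (M : IVModel n μ) (β₀ : ℝ) (i : Fin n) (ω : Ω) :
    M.r β₀ i ω = M.firstStage i * (1 - M.ρ β₀ i * (M.β - β₀)) + M.ζ β₀ i ω := by
  rw [r, nullError_eq, ζ, x]; ring

/-- Puts the fit in the affine form `b + a ζ` to which the moment and small-ball bounds apply. -/
lemma scale_mul_piHatI (hH : ∀ i, H i i = 0) (i : Fin n) (ω : Ω) :
    M.scale H β₀ * M.piHatI H β₀ i ω
      = M.shift H β₀ i + ∑ j, M.weight H β₀ i j * M.ζ β₀ j ω := by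
  rw [piHatI, Finset.sum_erase _ (by rw [hH i, zero_mul])]
  simp only [r_eq, shift, weight, mul_add, Finset.sum_add_distrib, Finset.mul_sum, mul_assoc]

lemma weight_self (hH : ∀ i, H i i = 0) (i : Fin n) : M.weight H β₀ i i = 0 := by
  rw [weight, hH i, mul_zero]

lemma measurable_η' (M : IVModel n μ) (β₀ : ℝ) (i : Fin n) : Measurable (M.η β₀ i) :=
  (M.measurable_η β₀ i).mono (M.obsSigma_le i) le_rfl

lemma measurable_ζ' (M : IVModel n μ) (β₀ : ℝ) (i : Fin n) : Measurable (M.ζ β₀ i) :=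
  (M.measurable_ζ β₀ i).mono (M.obsSigma_le i) le_rfl

namespace MomentConditions

lemma integrable_abs (hm : M.MomentConditions β₀ c) (hc : 1 < c) (i : Fin n) {l k : ℕ}
    (h : l + k ≤ 6) : Integrable (fun ω => |M.η β₀ i ω| ^ l * |M.ζ β₀ i ω| ^ k) μ := by
  -- A non-integrable function has integral `0` by convention, against the lower bound `c⁻¹ > 0`.
  by_contra hni
  have := (hm.moments i l k h).1
  rw [integral_undef hni] at this
  exact absurd this (not_le.2 (inv_pos.2 (by linarith)))

lemma integrable_pow_mul_pow (hm : M.MomentConditions β₀ c) (hc : 1 < c) (i : Fin n) {l k : ℕ}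
    (h : l + k ≤ 6) : Integrable (fun ω => M.η β₀ i ω ^ l * M.ζ β₀ i ω ^ k) μ :=
  (hm.integrable_abs hc i h).mono' (((M.measurable_η' β₀ i).pow_const l).mul
    ((M.measurable_ζ' β₀ i).pow_const k)).aestronglyMeasurable
    (.of_forall fun ω => by simp)

lemma abs_integral_le (hm : M.MomentConditions β₀ c) (i : Fin n) {l k : ℕ} (h : l + k ≤ 6) :
    |∫ ω, M.η β₀ i ω ^ l * M.ζ β₀ i ω ^ k ∂μ| ≤ c := by
  refine abs_integral_le_integral_abs.trans (le_trans (le_of_eq ?_) (hm.moments i l k h).2)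
  simp_rw [abs_mul, abs_pow]

lemma memLp_η (hm : M.MomentConditions β₀ c) (hc : 1 < c) (i : Fin n) :
    MemLp (M.η β₀ i) 4 μ :=
  memLp_four_of_integrable (M.measurable_η' β₀ i)
    (by simpa using hm.integrable_abs hc i (l := 4) (k := 0) (by norm_num))

lemma memLp_ζ (hm : M.MomentConditions β₀ c) (hc : 1 < c) (i : Fin n) :
    MemLp (M.ζ β₀ i) 4 μ :=
  memLp_four_of_integrable (M.measurable_ζ' β₀ i)
    (by simpa using hm.integrable_abs hc i (l := 0) (k := 4) (by norm_num))

lemma integral_η_sq (hm : M.MomentConditions β₀ c) (i : Fin n) :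
    c⁻¹ ≤ ∫ ω, M.η β₀ i ω ^ 2 ∂μ ∧ ∫ ω, M.η β₀ i ω ^ 2 ∂μ ≤ c := by
  simpa using hm.moments i 2 0 (by norm_num)

lemma integral_ζ_sq (hm : M.MomentConditions β₀ c) (i : Fin n) :
    c⁻¹ ≤ ∫ ω, M.ζ β₀ i ω ^ 2 ∂μ ∧ ∫ ω, M.ζ β₀ i ω ^ 2 ∂μ ≤ c := by
  simpa using hm.moments i 0 2 (by norm_num)

lemma integral_ζ_abs_cube (hm : M.MomentConditions β₀ c) (i : Fin n) :
    ∫ ω, |M.ζ β₀ i ω| ^ 3 ∂μ ≤ c := by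
  simpa using (hm.moments i 0 3 (by norm_num)).2

lemma integral_ζ_pow_four (hm : M.MomentConditions β₀ c) (i : Fin n) :
    ∫ ω, M.ζ β₀ i ω ^ 4 ∂μ ≤ c := by
  have := (abs_le.1 (hm.abs_integral_le i (l := 0) (k := 4) (by norm_num))).2
  simpa using this

lemma integral_η_pow_four (hm : M.MomentConditions β₀ c) (i : Fin n) :
    ∫ ω, M.η β₀ i ω ^ 4 ∂μ ≤ c := by
  have := (abs_le.1 (hm.abs_integral_le i (l := 4) (k := 0) (by norm_num))).2
  simpa using this

lemma abs_firstStage_mul_le (hm : M.MomentConditions β₀ c) (i : Fin n) :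
    |M.firstStage i * (M.β - β₀)| ≤ c ^ 2 := by
  have h := hm.bounded i
  have h1 := abs_nonneg (M.firstStage i)
  have h2 := abs_nonneg (M.β - β₀)
  have h3 := abs_nonneg (M.ρ β₀ i)
  rw [abs_mul, sq]
  exact mul_le_mul (by linarith) (by linarith) h2 (by linarith)

end MomentConditions

lemma BalancedDesign.pos (hb : M.BalancedDesign H β₀ c) (hc : 1 < c) : 0 < n := by
  rcases Nat.eq_zero_or_pos n with rfl | h
  · have := hb.average
    simp only [Finset.univ_eq_empty, Finset.sum_empty, mul_zero, integral_zero] at this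
    exact absurd this (not_le.2 (inv_pos.2 (by linarith)))
  · exact h

/-- Since `0⁻¹ = 0`, a degenerate supremum would make the scale vanish, and with it the average that
is required to be at least `c⁻¹`. -/
lemma BalancedDesign.scale_pos (hb : M.BalancedDesign H β₀ c) (hc : 1 < c) :
    0 < M.scale H β₀ := by
  refine lt_of_le_of_ne (inv_nonneg.2 (Real.sqrt_nonneg _)) fun h => ?_
  have := hb.average
  rw [← h] at this
  simp only [ne_eq, OfNat.ofNat_ne_zero, not_false_eq_true, zero_pow, zero_div, zero_mul,
    integral_zero] at this
  exact absurd this (not_le.2 (inv_pos.2 (by linarith)))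

lemma BalancedDesign.integral_scaled_sq_le_one (hb : M.BalancedDesign H β₀ c) (hc : 1 < c)
    (i : Fin n) : ∫ ω, (M.scale H β₀ * M.piHatI H β₀ i ω) ^ 2 ∂μ ≤ 1 := by
  have hs := hb.scale_pos hc
  simp_rw [mul_pow]
  rw [integral_const_mul]
  set S : ℝ := ⨆ i, ∫ ω, M.piHatI H β₀ i ω ^ 2 ∂μ with hS
  have hse : M.scale H β₀ = (√S)⁻¹ := rfl
  have hS0 : 0 < √S := by rw [hse] at hs; exact inv_pos.1 hs
  have hle : ∫ ω, M.piHatI H β₀ i ω ^ 2 ∂μ ≤ S :=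
    le_ciSup (f := fun i => ∫ ω, M.piHatI H β₀ i ω ^ 2 ∂μ) (Set.finite_range _).bddAbove i
  rw [hse, inv_pow, Real.sq_sqrt (Real.sqrt_pos.1 hS0).le]
  rw [inv_mul_le_iff₀ (Real.sqrt_pos.1 hS0), mul_one]
  exact hle

lemma BalancedDesign.weight_col (hb : M.BalancedDesign H β₀ c) (hH : ∀ i, H i i = 0)
    (j : Fin n) : ∑ i, M.weight H β₀ i j ^ 2 ≤ c := by
  have h := hb.leverage j
  rw [Finset.sum_erase _ (by rw [hH j]; norm_num), Finset.mul_sum] at h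
  simpa [weight, mul_pow] using h

lemma BalancedDesign.le_integral_sum_sq (hb : M.BalancedDesign H β₀ c) (hc : 1 < c)
    (hH : ∀ i, H i i = 0) :
    n * c⁻¹ ≤ ∫ ω, ∑ i, (M.shift H β₀ i + ∑ j, M.weight H β₀ i j * M.ζ β₀ j ω) ^ 2 ∂μ := by
  have hn : (0 : ℝ) < n := by exact_mod_cast hb.pos hc
  have e : ∀ ω, ∑ i, (M.shift H β₀ i + ∑ j, M.weight H β₀ i j * M.ζ β₀ j ω) ^ 2
      = n * (M.scale H β₀ ^ 2 / n * ∑ i, M.piHatI H β₀ i ω ^ 2) := fun ω => by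
    simp_rw [← scale_mul_piHatI hH, mul_pow, ← Finset.mul_sum]
    field_simp
  simp_rw [e]
  rw [integral_const_mul]
  exact mul_le_mul_of_nonneg_left hb.average hn.le

variable [IsProbabilityMeasure μ]

lemma integrable_v (M : IVModel n μ) (i : Fin n) : Integrable (M.v i) μ :=
  (M.memLp_v i).integrable (by norm_num)

lemma integrable_ε (M : IVModel n μ) (i : Fin n) : Integrable (M.ε i) μ :=
  (M.memLp_ε i).integrable (by norm_num)

lemma integrable_η (M : IVModel n μ) (β₀ : ℝ) (i : Fin n) : Integrable (M.η β₀ i) μ :=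
  ((M.integrable_v i).const_mul _).add (M.integrable_ε i)

lemma integral_η (M : IVModel n μ) (β₀ : ℝ) (i : Fin n) : ∫ ω, M.η β₀ i ω ∂μ = 0 := by
  simp only [η]
  rw [integral_add ((M.integrable_v i).const_mul _) (M.integrable_ε i), integral_const_mul,
    M.mean_v, M.mean_ε]
  simp

lemma integral_ζ (M : IVModel n μ) (β₀ : ℝ) (i : Fin n) : ∫ ω, M.ζ β₀ i ω ∂μ = 0 := by
  simp only [ζ]
  rw [integral_sub (M.integrable_v i) ((M.integrable_η β₀ i).const_mul _), integral_const_mul,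
    M.mean_v, M.integral_η]
  simp

/-- The normalization by the scale bounds the mean and the variance of each first-stage estimate. -/
lemma shift_sq_add_weight_row_le (hm : M.MomentConditions β₀ c) (hb : M.BalancedDesign H β₀ c)
    (hc : 1 < c) (hH : ∀ i, H i i = 0) (i : Fin n) :
    M.shift H β₀ i ^ 2 ≤ 1 ∧ ∑ j, M.weight H β₀ i j ^ 2 ≤ c := by
  have hc0 : 0 < c := by linarith
  have h := hb.integral_scaled_sq_le_one hc i
  simp_rw [scale_mul_piHatI hH] at h
  obtain ⟨i4, i0, i2, -⟩ := linear_moments M.obsSigma_le M.iIndep_obsSigma (M.measurable_ζ β₀)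
    (hm.memLp_ζ hc) (M.integral_ζ β₀) hc.le (fun j => (hm.integral_ζ_sq j).2)
    hm.integral_ζ_pow_four (M.weight H β₀ i) Finset.univ
  have hi1 := (i4.integrable (by norm_num)).const_mul (2 * M.shift H β₀ i)
  have hi2 := integrable_pow_of_memLp_four i4 (k := 2) (by norm_num)
  -- The cross term has mean zero, so squared shift plus variance is at most `1`; each `ζ j` having
  -- second moment at least `c⁻¹`, the row of weights is bounded by `c`.
  simp_rw [add_sq] at h
  rw [integral_add ((integrable_const _).fun_add hi1) hi2, integral_add (integrable_const _) hi1,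
    integral_const_mul, i0, i2, integral_const] at h
  simp only [probReal_univ, one_smul, mul_zero, add_zero] at h
  have hV : c⁻¹ * ∑ j, M.weight H β₀ i j ^ 2
      ≤ ∑ j, M.weight H β₀ i j ^ 2 * ∫ ω, M.ζ β₀ j ω ^ 2 ∂μ := by
    rw [Finset.mul_sum]
    refine Finset.sum_le_sum fun j _ => ?_
    rw [mul_comm]
    exact mul_le_mul_of_nonneg_left (hm.integral_ζ_sq j).1 (sq_nonneg _)
  have hV0 : 0 ≤ c⁻¹ * ∑ j, M.weight H β₀ i j ^ 2 :=
    mul_nonneg (inv_nonneg.2 hc0.le) (Finset.sum_nonneg fun j _ => sq_nonneg _)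
  refine ⟨by linarith, ?_⟩
  have h1 : c⁻¹ * ∑ j, M.weight H β₀ i j ^ 2 ≤ 1 := by nlinarith [sq_nonneg (M.shift H β₀ i)]
  rwa [inv_mul_le_iff₀ hc0, mul_one] at h1

end IVModel

/-- The constant in the second moment bound of `weighted_sum_second_moment`. -/
def sumBound (c J : ℝ) : ℝ :=
  J * (1 + 8 * (c ^ 2 + 3 * c ^ 2 * c ^ 2))
    + 16 * (c ^ 3 * (4 + 4 * (8 * (c ^ 2 + 3 * c ^ 2 * c ^ 2))) * J ^ 2)

/-! ### The infeasible numerator and denominator. -/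

namespace IVModel

variable {n : ℕ} {Ω : Type*} [mΩ : MeasurableSpace Ω] {μ : Measure Ω} {M : IVModel n μ}
  {H : Matrix (Fin n) (Fin n) ℝ} {β₀ c : ℝ}

/-- The scaled infeasible first-stage estimate. -/
def scaledFit (M : IVModel n μ) (H : Matrix (Fin n) (Fin n) ℝ) (β₀ : ℝ) (i : Fin n) (ω : Ω) : ℝ :=
  M.shift H β₀ i + ∑ j, M.weight H β₀ i j * M.ζ β₀ j ω

/-- The scaled infeasible numerator. -/
def numI (M : IVModel n μ) (H : Matrix (Fin n) (Fin n) ℝ) (β₀ : ℝ) (ω : Ω) : ℝ :=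
  M.scale H β₀ / √n * ∑ i, M.nullError β₀ i ω * M.piHatI H β₀ i ω

/-- The scaled infeasible denominator. -/
def denI (M : IVModel n μ) (H : Matrix (Fin n) (Fin n) ℝ) (β₀ : ℝ) (ω : Ω) : ℝ :=
  M.scale H β₀ ^ 2 / n * ∑ i, M.nullError β₀ i ω ^ 2 * M.piHatI H β₀ i ω ^ 2

/-- The centred squared null error. -/
def sqError (M : IVModel n μ) (β₀ : ℝ) (i : Fin n) (ω : Ω) : ℝ :=
  M.η β₀ i ω ^ 2 - ∫ ω, M.η β₀ i ω ^ 2 ∂μ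
    + 2 * (M.firstStage i * (M.β - β₀)) * M.η β₀ i ω

/-- The first part is controlled by the power index, the second is a centred weighted sum with `d =
1`. -/
lemma numI_eq (hH : ∀ i, H i i = 0) (ω : Ω) :
    M.numI H β₀ ω
      = (M.β - β₀) * (M.scale H β₀ / √n * ∑ i, M.firstStage i * M.piHatI H β₀ i ω)
        + (√n)⁻¹ * ∑ i, M.η β₀ i ω * M.scaledFit H β₀ i ω ^ 1 := by
  simp_rw [pow_one, scaledFit, ← scale_mul_piHatI hH, numI, nullError_eq, Finset.mul_sum]
  rw [← Finset.sum_add_distrib]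
  exact Finset.sum_congr rfl fun i _ => by ring

/-- Replaces the squared null errors by their means. Under the moment conditions these are at least
`c⁻¹`, and the centred remainder is a weighted sum with `d = 2`. -/
lemma nat_mul_denI_eq (hn : 0 < n) (hH : ∀ i, H i i = 0) (ω : Ω) :
    n * M.denI H β₀ ω = ∑ i, M.sqError β₀ i ω * M.scaledFit H β₀ i ω ^ 2
      + ∑ i, ((M.firstStage i * (M.β - β₀)) ^ 2 + ∫ ω, M.η β₀ i ω ^ 2 ∂μ)
        * M.scaledFit H β₀ i ω ^ 2 := by
  have hn0 : (n : ℝ) ≠ 0 := by exact_mod_cast hn.ne'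
  simp_rw [scaledFit, ← scale_mul_piHatI hH, denI, nullError_eq]
  rw [← Finset.sum_add_distrib, ← mul_assoc, mul_div_cancel₀ _ hn0, Finset.mul_sum]
  exact Finset.sum_congr rfl fun i _ => by simp only [sqError]; ring

lemma measurable_sqError (M : IVModel n μ) (β₀ : ℝ) (i : Fin n) :
    Measurable[M.obsSigma i] (M.sqError β₀ i) :=
  (((M.measurable_η β₀ i).pow_const 2).sub_const _).add ((M.measurable_η β₀ i).const_mul _)

variable [IsProbabilityMeasure μ]

/-- The scaled infeasible numerator is bounded in probability. -/
lemma measureReal_le_abs_numI_le (hm : M.MomentConditions β₀ c) (hb : M.BalancedDesign H β₀ c)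
    (hl : M.LocalIdentification H β₀ c) (hc : 1 < c) (hH : ∀ i, H i i = 0) {T : ℝ} (hT : 0 < T) :
    μ.real {ω | T ≤ |M.numI H β₀ ω|} ≤ (2 * c + 2 * sumBound c c) / T ^ 2 := by
  have hn := hb.pos hc
  have hn0 : (0 : ℝ) < n := by exact_mod_cast hn
  have hc1 : c⁻¹ ≤ c := (inv_le_one_of_one_le₀ hc.le).trans hc.le
  obtain ⟨W2, WV⟩ := weighted_sum_second_moment M.obsSigma_le M.iIndep_obsSigma
    (M.measurable_ζ β₀) (hm.memLp_ζ hc) (M.integral_ζ β₀) hc.le (fun j => (hm.integral_ζ_sq j).2)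
    hm.integral_ζ_pow_four (M.measurable_η β₀)
    (fun j => (hm.memLp_η hc j).mono_exponent (by norm_num)) (M.integral_η β₀)
    (fun j => (hm.integral_η_sq j).2)
    (fun j q hq => by simpa using hm.integrable_pow_mul_pow hc j (l := 1) (k := q) (by omega))
    (fun j q hq => by simpa using hm.abs_integral_le j (l := 1) (k := q) (by omega))
    (a := M.weight H β₀) (weight_self hH) (b := M.shift H β₀) hc.le
    (fun i => (shift_sq_add_weight_row_le hm hb hc hH i).1.trans hc.le)
    (fun i => (shift_sq_add_weight_row_le hm hb hc hH i).2) (d := 1) (by norm_num)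
  set W : Ω → ℝ := fun ω => ∑ i, M.η β₀ i ω * M.scaledFit H β₀ i ω ^ 1 with hW
  change MemLp W 2 μ at W2
  change ∫ ω, W ω ^ 2 ∂μ ≤ _ at WV
  set R : Ω → ℝ := fun ω => M.scale H β₀ / √n * ∑ i, M.firstStage i * M.piHatI H β₀ i ω with hR
  have hR2 : MemLp R 2 μ := by
    have hQ : ∀ i, MemLp (M.scaledFit H β₀ i) 4 μ := fun i =>
      (affine_fourth_moment M.obsSigma_le M.iIndep_obsSigma (M.measurable_ζ β₀) (hm.memLp_ζ hc)
        (M.integral_ζ β₀) hc.le (fun j => (hm.integral_ζ_sq j).2) hm.integral_ζ_pow_four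
        ((shift_sq_add_weight_row_le hm hb hc hH i).1.trans hc.le)
        (shift_sq_add_weight_row_le hm hb hc hH i).2).1
    have e : R = fun ω => ∑ i, (M.firstStage i / √n) * M.scaledFit H β₀ i ω := by
      funext ω
      simp_rw [hR, scaledFit, ← scale_mul_piHatI hH, Finset.mul_sum]
      exact Finset.sum_congr rfl fun i _ => by ring
    rw [e]
    exact memLp_finsetSum _ fun i _ => ((hQ i).mono_exponent (by norm_num)).const_mul _
  have hN2 : MemLp (M.numI H β₀) 2 μ := by
    rw [show M.numI H β₀ = _ from funext (numI_eq hH)]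
    exact (hR2.const_mul _).add (W2.const_mul _)
  have hEN : ∫ ω, M.numI H β₀ ω ^ 2 ∂μ ≤ 2 * c + 2 * sumBound c c := by
    have h1 : ∫ ω, M.numI H β₀ ω ^ 2 ∂μ
        ≤ ∫ ω, (2 * (M.β - β₀) ^ 2 * R ω ^ 2 + 2 / n * W ω ^ 2) ∂μ := by
      refine integral_mono hN2.integrable_sq ((hR2.integrable_sq.const_mul _).fun_add
        (W2.integrable_sq.const_mul _)) fun ω => ?_
      have e : M.numI H β₀ ω = (M.β - β₀) * R ω + (√n)⁻¹ * W ω := numI_eq hH ω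
      have e2 : 2 / (n : ℝ) * W ω ^ 2 = 2 * ((√n)⁻¹ * W ω) ^ 2 := by
        rw [mul_pow, inv_pow, Real.sq_sqrt hn0.le]; ring
      simp only [e, e2]
      nlinarith [sq_nonneg ((M.β - β₀) * R ω - (√n)⁻¹ * W ω)]
    rw [integral_add (hR2.integrable_sq.const_mul _) (W2.integrable_sq.const_mul _),
      integral_const_mul, integral_const_mul] at h1
    have h2 : (M.β - β₀) ^ 2 * ∫ ω, R ω ^ 2 ∂μ ≤ c := hl.power
    have h3 : 2 / (n : ℝ) * ∫ ω, W ω ^ 2 ∂μ ≤ 2 * sumBound c c := by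
      have h4 : ∫ ω, W ω ^ 2 ∂μ ≤ sumBound c c * n := by simpa [sumBound] using WV
      rw [div_mul_eq_mul_div, div_le_iff₀ hn0]
      linarith
    linarith
  have hmk := mul_meas_ge_le_integral_of_nonneg (μ := μ) (f := fun ω => M.numI H β₀ ω ^ 2)
    (.of_forall fun ω => sq_nonneg _) hN2.integrable_sq (T ^ 2)
  rw [le_div_iff₀ (by positivity), mul_comm]
  refine le_trans (mul_le_mul_of_nonneg_left (measureReal_mono fun ω hω => ?_) (sq_nonneg T))
    (hmk.trans hEN)
  simp only [Set.mem_ofPred_eq] at hω ⊢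
  rw [← sq_abs (M.numI H β₀ ω)]
  exact pow_le_pow_left₀ hT.le hω 2

/-- Verifies the hypotheses of `weighted_sum_second_moment` for the denominator. The crude constant
covers `4 c + 4 c² + 8 c⁵`, the last term coming from `|Π (β - β₀)| ≤ c²`. -/
lemma sqError_moments (hm : M.MomentConditions β₀ c) (hc : 1 < c) (i : Fin n) :
    MemLp (M.sqError β₀ i) 2 μ ∧ ∫ ω, M.sqError β₀ i ω ∂μ = 0 ∧
      ∫ ω, M.sqError β₀ i ω ^ 2 ∂μ ≤ 16 * c ^ 5 ∧
      ∀ q ≤ 2, Integrable (fun ω => M.sqError β₀ i ω * M.ζ β₀ i ω ^ q) μ ∧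
        |∫ ω, M.sqError β₀ i ω * M.ζ β₀ i ω ^ q ∂μ| ≤ 16 * c ^ 5 := by
  set τ : ℝ := ∫ ω, M.η β₀ i ω ^ 2 ∂μ with hτ
  set p : ℝ := M.firstStage i * (M.β - β₀) with hp
  have hc0 : 0 < c := by linarith
  have hp2 : |p| ≤ c ^ 2 := hm.abs_firstStage_mul_le i
  have hτ0 : 0 ≤ τ := integral_nonneg fun ω => sq_nonneg _
  have hτc : τ ≤ c := (hm.integral_η_sq i).2
  have hc5 : ∀ k ≤ 5, c ^ k ≤ c ^ 5 := fun k hk => pow_le_pow_right₀ hc.le hk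
  have h1 : Integrable (M.η β₀ i) μ := M.integrable_η β₀ i
  have h2 := integrable_pow_of_memLp_four (hm.memLp_η hc i) (k := 2) (by norm_num)
  have h4 := integrable_pow_of_memLp_four (hm.memLp_η hc i) le_rfl
  have hdom : Integrable (fun ω => 4 * M.η β₀ i ω ^ 4 + (4 * τ ^ 2 + 8 * p ^ 2 * M.η β₀ i ω ^ 2))
      μ := (h4.const_mul _).add ((integrable_const _).add (h2.const_mul _))
  have hmeas : Measurable (M.sqError β₀ i) :=
    (M.measurable_sqError β₀ i).mono (M.obsSigma_le i) le_rfl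
  have hcen : Integrable (fun ω => M.η β₀ i ω ^ 2 - τ) μ := h2.sub (integrable_const _)
  have hle : ∀ ω, M.sqError β₀ i ω ^ 2
      ≤ 4 * M.η β₀ i ω ^ 4 + (4 * τ ^ 2 + 8 * p ^ 2 * M.η β₀ i ω ^ 2) := fun ω => by
    simp only [sqError, ← hτ, ← hp]
    nlinarith [sq_nonneg (M.η β₀ i ω ^ 2 - τ - 2 * p * M.η β₀ i ω),
      sq_nonneg (M.η β₀ i ω ^ 2 + τ)]
  have hL : MemLp (M.sqError β₀ i) 2 μ := by
    refine memLp_two_of_integrable_sq hmeas (hdom.mono' (hmeas.pow_const 2).aestronglyMeasurable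
      (.of_forall fun ω => ?_))
    rw [Real.norm_of_nonneg (sq_nonneg _)]
    exact hle ω
  refine ⟨hL, ?_, ?_, fun q hq => ?_⟩
  · simp only [sqError, ← hτ, ← hp]
    rw [integral_add hcen (h1.const_mul _), integral_sub h2 (integrable_const _),
      integral_const_mul, M.integral_η]
    simp [← hτ]
  · refine (integral_mono hL.integrable_sq hdom hle).trans ?_
    rw [integral_add (h4.const_mul _) ((integrable_const _).fun_add (h2.const_mul _)),
      integral_add (integrable_const _) (h2.const_mul _), integral_const, integral_const_mul,
      integral_const_mul, ← hτ]
    simp only [probReal_univ, one_smul]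
    have k1 := hm.integral_η_pow_four i
    have k2 : τ ^ 2 ≤ c ^ 2 := pow_le_pow_left₀ hτ0 hτc 2
    have k3 : p ^ 2 * τ ≤ c ^ 4 * c := by
      refine mul_le_mul ?_ hτc hτ0 (by positivity)
      rw [← sq_abs, show c ^ 4 = (c ^ 2) ^ 2 by ring]
      exact pow_le_pow_left₀ (abs_nonneg _) hp2 2
    linarith [hc5 1 (by norm_num), hc5 2 (by norm_num), pow_one c]
  · have j2 := hm.integrable_pow_mul_pow hc i (l := 2) (k := q) (by omega)
    have j1 := hm.integrable_pow_mul_pow hc i (l := 1) (k := q) (by omega)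
    have j0 := hm.integrable_pow_mul_pow hc i (l := 0) (k := q) (by omega)
    have e : ∀ ω, M.sqError β₀ i ω * M.ζ β₀ i ω ^ q
        = M.η β₀ i ω ^ 2 * M.ζ β₀ i ω ^ q + ((-τ) * (M.η β₀ i ω ^ 0 * M.ζ β₀ i ω ^ q)
          + 2 * p * (M.η β₀ i ω ^ 1 * M.ζ β₀ i ω ^ q)) := fun ω => by
      simp only [sqError, ← hτ, ← hp]; ring
    simp_rw [e]
    have j3 := (j0.const_mul (-τ)).fun_add (j1.const_mul (2 * p))
    refine ⟨j2.add j3, ?_⟩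
    rw [integral_add j2 j3, integral_add (j0.const_mul _) (j1.const_mul _), integral_const_mul,
      integral_const_mul]
    have a2 := hm.abs_integral_le i (l := 2) (k := q) (by omega)
    have a1 := hm.abs_integral_le i (l := 1) (k := q) (by omega)
    have a0 := hm.abs_integral_le i (l := 0) (k := q) (by omega)
    have k0 : |(-τ) * ∫ ω, M.η β₀ i ω ^ 0 * M.ζ β₀ i ω ^ q ∂μ| ≤ c * c := by
      rw [abs_mul, abs_neg, abs_of_nonneg hτ0]
      exact mul_le_mul hτc a0 (abs_nonneg _) hc0.le
    have k1 : |2 * p * ∫ ω, M.η β₀ i ω ^ 1 * M.ζ β₀ i ω ^ q ∂μ| ≤ 2 * c ^ 2 * c := by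
      rw [abs_mul, abs_mul, abs_two]
      exact mul_le_mul (by linarith) a1 (abs_nonneg _) (by positivity)
    refine (abs_add_le _ _).trans ((add_le_add a2 ((abs_add_le _ _).trans
      (add_le_add k0 k1))).trans ?_)
    have := hc5 0 (by norm_num)
    linarith [hc5 1 (by norm_num), hc5 2 (by norm_num), hc5 3 (by norm_num), pow_one c]

/-- The scaled infeasible denominator is small with small probability only. -/
lemma measureReal_denI_le_le (hm : M.MomentConditions β₀ c) (hb : M.BalancedDesign H β₀ c)
    (hc : 1 < c) (hH : ∀ i, H i i = 0) {κ r : ℝ} (hκ : 0 < κ) (hr : 0 < r) :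
    μ.real {ω | M.denI H β₀ ω ≤ min (1 / (2 * c)) (r ^ 2) / (2 * c)}
      ≤ 64 * c ^ 4 * (κ * (1 + c)) + 2 * (r * √(4 * Real.pi * c / κ))
        + (sumBound c (16 * c ^ 5) / (min (1 / (2 * c)) (r ^ 2) / (2 * c)) ^ 2
          + 64 * c ^ 6 + 2 * (256 * c ^ 5 / r ^ 2)) / n := by
  have hn := hb.pos hc
  have hn0 : (0 : ℝ) < n := by exact_mod_cast hn
  have hc0 : 0 < c := by linarith
  set D : ℝ := min (1 / (2 * c)) (r ^ 2) with hD
  have hD0 : 0 < D := lt_min (by positivity) (by positivity)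
  obtain ⟨W2, WV⟩ := weighted_sum_second_moment M.obsSigma_le M.iIndep_obsSigma
    (M.measurable_ζ β₀) (hm.memLp_ζ hc) (M.integral_ζ β₀) hc.le (fun j => (hm.integral_ζ_sq j).2)
    hm.integral_ζ_pow_four (M.measurable_sqError β₀)
    (fun j => (sqError_moments hm hc j).1) (fun j => (sqError_moments hm hc j).2.1)
    (fun j => (sqError_moments hm hc j).2.2.1)
    (fun j q hq => ((sqError_moments hm hc j).2.2.2 q hq).1)
    (fun j q hq => ((sqError_moments hm hc j).2.2.2 q hq).2)
    (a := M.weight H β₀) (weight_self hH) (b := M.shift H β₀) hc.le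
    (fun i => (shift_sq_add_weight_row_le hm hb hc hH i).1.trans hc.le)
    (fun i => (shift_sq_add_weight_row_le hm hb hc hH i).2) (d := 2) le_rfl
  set W : Ω → ℝ := fun ω => ∑ i, M.sqError β₀ i ω * M.scaledFit H β₀ i ω ^ 2 with hW
  change MemLp W 2 μ at W2
  change ∫ ω, W ω ^ 2 ∂μ ≤ _ at WV
  have hWV : ∫ ω, W ω ^ 2 ∂μ ≤ sumBound c (16 * c ^ 5) * n := by simpa [sumBound] using WV
  set S : Ω → ℝ := fun ω => ∑ i, M.scaledFit H β₀ i ω ^ 2 with hS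
  -- Off both events, `n * denI ≥ W + c⁻¹ S > -n D / (2 c) + n D / c = n D / (2 c)`.
  have hsub : {ω | M.denI H β₀ ω ≤ D / (2 * c)}
      ⊆ {ω | (n * (D / (2 * c))) ^ 2 ≤ W ω ^ 2} ∪ {ω | S ω ≤ D * n} := by
    intro ω hω
    simp only [Set.mem_ofPred_eq, Set.mem_union] at hω ⊢
    by_contra! hcon
    have h1 : |W ω| < n * (D / (2 * c)) := abs_lt_of_sq_lt_sq hcon.1 (by positivity)
    have h2 : c⁻¹ * S ω ≤ ∑ i, ((M.firstStage i * (M.β - β₀)) ^ 2 + ∫ ω, M.η β₀ i ω ^ 2 ∂μ)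
        * M.scaledFit H β₀ i ω ^ 2 := by
      rw [hS, Finset.mul_sum]
      refine Finset.sum_le_sum fun i _ => mul_le_mul_of_nonneg_right ?_ (sq_nonneg _)
      linarith [(hm.integral_η_sq i).1, sq_nonneg (M.firstStage i * (M.β - β₀))]
    have h3 : n * M.denI H β₀ ω = W ω + _ := nat_mul_denI_eq hn hH ω
    have h4 := mul_le_mul_of_nonneg_left hω hn0.le
    have h5 : c⁻¹ * (D * n) < c⁻¹ * S ω := mul_lt_mul_of_pos_left hcon.2 (inv_pos.2 hc0)
    have h6 : c⁻¹ * (D * n) = 2 * (n * (D / (2 * c))) := by field_simp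
    linarith [(abs_lt.1 h1).1]
  have hWtail : μ.real {ω | (n * (D / (2 * c))) ^ 2 ≤ W ω ^ 2}
      ≤ sumBound c (16 * c ^ 5) / (D / (2 * c)) ^ 2 / n := by
    have hmk := mul_meas_ge_le_integral_of_nonneg (μ := μ) (f := fun ω => W ω ^ 2)
      (.of_forall fun ω => sq_nonneg _) W2.integrable_sq ((n * (D / (2 * c))) ^ 2)
    refine le_of_mul_le_mul_left ((hmk.trans hWV).trans (le_of_eq ?_))
      (by positivity : 0 < ((n : ℝ) * (D / (2 * c))) ^ 2)
    field_simp
  have hStail : μ.real {ω | S ω ≤ D * n}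
      ≤ 64 * c ^ 4 * (κ * (1 + c)) + 2 * (r * √(4 * Real.pi * c / κ))
        + (64 * c ^ 6 + 2 * (256 * c ^ 5 / r ^ 2)) / n := by
    -- Both cases must be covered for each `n` separately, so the bound adds the two estimates.
    by_cases hspec : ∀ u : Fin n → ℝ,
        ∑ j, (∑ i, u i * M.weight H β₀ i j) ^ 2 ≤ κ * n * ∑ i, u i ^ 2
    · have h := measureReal_sum_sq_le_of_forall M.obsSigma_le M.iIndep_obsSigma
        (M.measurable_ζ β₀) (hm.memLp_ζ hc) (M.integral_ζ β₀) hc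
        (fun j => (hm.integral_ζ_sq j).2) hm.integral_ζ_pow_four hn (hb.weight_col hH)
        (fun i => (shift_sq_add_weight_row_le hm hb hc hH i).1) (hb.le_integral_sum_sq hc hH) hκ
        hspec
      refine (measureReal_mono fun ω hω => ?_).trans (h.trans ?_)
      · simp only [Set.mem_ofPred_eq] at hω ⊢
        refine hω.trans ?_
        rw [← one_div_mul_eq_div]
        exact mul_le_mul_of_nonneg_right (min_le_left _ _) hn0.le
      · have e : 64 * c ^ 4 * (c ^ 2 / n + κ * (1 + c))
            = 64 * c ^ 4 * (κ * (1 + c)) + 64 * c ^ 6 / n := by ring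
        rw [e, add_div]
        have h1 : 0 ≤ 2 * (r * √(4 * Real.pi * c / κ)) := by positivity
        have h2 : 0 ≤ 2 * (256 * c ^ 5 / r ^ 2) / n := by positivity
        linarith
    · push Not at hspec
      obtain ⟨u, hu⟩ := hspec
      have h := measureReal_sum_sq_le_of_exists (M.iIndepFun_ζ β₀) (M.measurable_ζ' β₀)
        (hm.memLp_ζ hc) (M.integral_ζ β₀) hc (fun j => (hm.integral_ζ_sq j).1)
        (fun j => (hm.integral_ζ_sq j).2) hm.integral_ζ_abs_cube hn (hb.weight_col hH)
        (M.shift H β₀) hκ hu hr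
      refine (measureReal_mono fun ω hω => ?_).trans (h.trans ?_)
      · simp only [Set.mem_ofPred_eq] at hω ⊢
        exact hω.trans (mul_le_mul_of_nonneg_right (min_le_right _ _) hn0.le)
      · have e : (16 * c ^ 2 * √(c / n) / r) ^ 2 = 256 * c ^ 5 / r ^ 2 / n := by
          rw [div_pow, mul_pow, Real.sq_sqrt (by positivity)]
          field_simp
          ring
        rw [e, add_div]
        have h1 : 0 ≤ 64 * c ^ 4 * (κ * (1 + c)) := by positivity
        have h2 : 0 ≤ 64 * c ^ 6 / n := by positivity
        have h3 : 2 * (256 * c ^ 5 / r ^ 2 / n) = 2 * (256 * c ^ 5 / r ^ 2) / n := by ring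
        linarith
  refine (measureReal_mono hsub).trans ((measureReal_union_le _ _).trans
    ((add_le_add hWtail hStail).trans (le_of_eq ?_)))
  ring

end IVModel

/-! ### Stability of the ratio, and the uniform lower bound on the denominator. -/

lemma kRatio_eq_div {n : ℕ} (e p : Fin n → ℝ) {s : ℝ} (hs : 0 < s) (hn : 0 < n)
    (h : 0 < s ^ 2 / n * ∑ i, e i ^ 2 * p i ^ 2) :
    kRatio e p = (s / √n * ∑ i, e i * p i) ^ 2 / (s ^ 2 / n * ∑ i, e i ^ 2 * p i ^ 2) := by
  have hn0 : (0 : ℝ) < n := by exact_mod_cast hn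
  have hk : 0 < s ^ 2 / (n : ℝ) := by positivity
  have h1 : 0 < ∑ i, e i ^ 2 * p i ^ 2 := pos_of_mul_pos_right h hk.le
  rw [kRatio, if_pos h1, mul_pow, div_pow, Real.sq_sqrt hn0.le, mul_div_mul_left _ _ hk.ne']

/-- Stability of a ratio `N ^ 2 / D` whose denominator is bounded away from zero. -/
lemma abs_sq_div_sub_le {N D x y T d γ : ℝ} (hd : 0 < d) (hT : 0 ≤ T) (hN : |N| ≤ T)
    (hD : d ≤ D) (hx : |x| ≤ γ) (hy : |y| ≤ γ) (hγ1 : γ ≤ 1) (hγd : γ ≤ d / 2) :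
    |(N + x) ^ 2 / (D + y) - N ^ 2 / D| ≤ γ * (2 * (2 * T + 1) / d + 2 * T ^ 2 / d ^ 2) := by
  have hγ0 : 0 ≤ γ := (abs_nonneg x).trans hx
  have hD0 : 0 < D := hd.trans_le hD
  have hDy : d / 2 ≤ D + y := by linarith [(abs_le.1 hy).1]
  have hDy0 : 0 < D + y := by linarith
  have e : (N + x) ^ 2 / (D + y) - N ^ 2 / D
      = x * (2 * N + x) / (D + y) - N ^ 2 * y / (D * (D + y)) := by
    field_simp; ring
  rw [e]
  have h1 : |x * (2 * N + x) / (D + y)| ≤ γ * (2 * T + 1) / (d / 2) := by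
    rw [abs_div, abs_of_pos hDy0, abs_mul]
    have : |2 * N + x| ≤ 2 * T + 1 := by
      refine (abs_add_le _ _).trans ?_
      rw [abs_mul, abs_two]; linarith
    gcongr
  have h2 : |N ^ 2 * y / (D * (D + y))| ≤ T ^ 2 * γ / (d * (d / 2)) := by
    rw [abs_div, abs_of_pos (mul_pos hD0 hDy0), abs_mul, abs_pow]
    gcongr
  refine (abs_sub _ _).trans ((add_le_add h1 h2).trans (le_of_eq ?_))
  field_simp

/-- The order of choice matters: `κ` settles the concentration term, then `r`, depending on `κ`, the
anti-concentration term, and the rest is `O(1 / n)`. The resulting `d` depends on `c` and `ε` only,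
as the model changes with `n`. -/
lemma exists_denI_bound {c : ℝ} (hc : 1 < c) {ε : ℝ} (hε : 0 < ε) :
    ∃ d : ℝ, 0 < d ∧ ∀ᶠ n : ℕ in atTop, ∀ {Ω : Type*} [MeasurableSpace Ω] (μ : Measure Ω)
      [IsProbabilityMeasure μ] (M : IVModel n μ) (H : Matrix (Fin n) (Fin n) ℝ) (β₀ : ℝ),
      M.MomentConditions β₀ c → M.BalancedDesign H β₀ c → (∀ i, H i i = 0) →
      μ.real {ω | M.denI H β₀ ω ≤ d} ≤ ε := by
  have hc0 : 0 < c := by linarith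
  obtain ⟨κ, hκ, hκε⟩ : ∃ κ : ℝ, 0 < κ ∧ 64 * c ^ 4 * (κ * (1 + c)) = ε / 4 :=
    ⟨ε / 4 / (64 * c ^ 4 * (1 + c)), by positivity, by field_simp⟩
  set q : ℝ := √(4 * Real.pi * c / κ) with hq
  have hq0 : 0 < q := Real.sqrt_pos.2 (by have := Real.pi_pos; positivity)
  obtain ⟨r, hr, hrε⟩ : ∃ r : ℝ, 0 < r ∧ 2 * (r * q) = ε / 4 :=
    ⟨ε / (8 * q), by positivity, by field_simp; norm_num⟩
  refine ⟨min (1 / (2 * c)) (r ^ 2) / (2 * c),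
    div_pos (lt_min (by positivity) (by positivity)) (by positivity), ?_⟩
  have hlim := tendsto_const_div_atTop_nhds_zero_nat
    (sumBound c (16 * c ^ 5) / (min (1 / (2 * c)) (r ^ 2) / (2 * c)) ^ 2
          + 64 * c ^ 6 + 2 * (256 * c ^ 5 / r ^ 2))
  filter_upwards [hlim.eventually (gt_mem_nhds (by positivity : 0 < ε / 2))] with n hn
  intro Ω _ μ _ M H β₀ hm hb hH
  have := IVModel.measureReal_denI_le_le hm hb hc hH hκ hr
  rw [← hq] at this
  linarith

end JackknifeIV

end

/-! ### Conclusion. -/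

theorem mainTheorem9
    {Ω : ℕ → Type*} [∀ n, MeasurableSpace (Ω n)]
    (μ : ∀ n, Measure (Ω n)) [∀ n, IsProbabilityMeasure (μ n)]
    (M : ∀ n, JackknifeIV.IVModel n (μ n)) (β₀ : ℝ)
    (H : ∀ n, Matrix (Fin n) (Fin n) ℝ) (hH : ∀ n i, H n i i = 0)
    (ρhat : ∀ n, Fin n → Ω n → ℝ) (hρhat : ∀ n i, Measurable (ρhat n i))
    (c : ℝ) (hc : 1 < c)
    (hmom : ∀ᶠ n in atTop, (M n).MomentConditions β₀ c)
    (hbal : ∀ᶠ n in atTop, (M n).BalancedDesign (H n) β₀ c)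
    (hloc : ∀ᶠ n in atTop, (M n).LocalIdentification (H n) β₀ c)
    (hΔ : JackknifeIV.TendstoInProbZero μ (fun n ω =>
      ((M n).ΔN (H n) β₀ (ρhat n) ω, (M n).ΔD (H n) β₀ (ρhat n) ω))) :
    JackknifeIV.TendstoInProbZero μ (fun n ω =>
      |(M n).JK (H n) β₀ (ρhat n) ω - (M n).JKI (H n) β₀ ω|) := by
  intro δ hδ
  rw [ENNReal.tendsto_nhds_zero]
  intro ε₀ hε₀
  -- The tolerance may be infinite, hence the cap at `1`.
  obtain ⟨ε, hε, hεε₀⟩ : ∃ ε : ℝ, 0 < ε ∧ ENNReal.ofReal ε ≤ ε₀ := by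
    have h1 : min ε₀ 1 ≠ ⊤ := ne_top_of_le_ne_top ENNReal.one_ne_top (min_le_right _ _)
    refine ⟨(min ε₀ 1).toReal, ENNReal.toReal_pos (lt_min hε₀ one_pos).ne' h1, ?_⟩
    rw [ENNReal.ofReal_toReal h1]
    exact min_le_left _ _
  obtain ⟨d, hd, hden⟩ := JackknifeIV.exists_denI_bound hc (by positivity : 0 < ε / 3)
  set C : ℝ := 2 * c + 2 * JackknifeIV.sumBound c c with hC
  have hC0 : 0 < C := by
    have : 0 < c := by linarith
    simp only [hC, JackknifeIV.sumBound]; positivity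
  -- Chosen so that the Chebyshev bound `C / T ^ 2` for the numerator equals `ε / 3`.
  set T : ℝ := √(3 * C / ε) with hT
  have hT0 : 0 < T := Real.sqrt_pos.2 (by positivity)
  have hTC : C / T ^ 2 = ε / 3 := by
    rw [hT, Real.sq_sqrt (by positivity)]; field_simp
  set L : ℝ := 2 * (2 * T + 1) / d + 2 * T ^ 2 / d ^ 2 with hL
  have hL0 : 0 < L := by positivity
  -- The first two bounds are those `abs_sq_div_sub_le` asks for; the third makes its conclusion at
  -- most `δ / 2`.
  set γ : ℝ := min (min 1 (d / 2)) (δ / (2 * L)) with hγ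
  have hγ0 : 0 < γ := lt_min (lt_min one_pos (by positivity)) (by positivity)
  have hγ1 : γ ≤ 1 := (min_le_left _ _).trans (min_le_left _ _)
  have hγd : γ ≤ d / 2 := (min_le_left _ _).trans (min_le_right _ _)
  have hγδ : γ * L < δ := by
    have h := mul_le_mul_of_nonneg_right (min_le_right (min 1 (d / 2)) (δ / (2 * L))) hL0.le
    have e : δ / (2 * L) * L = δ / 2 := by field_simp
    rw [e] at h
    linarith
  have hΔγ := (ENNReal.tendsto_nhds_zero.1 (hΔ γ hγ0)) (ENNReal.ofReal (ε / 3))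
    (ENNReal.ofReal_pos.2 (by positivity))
  filter_upwards [hmom, hbal, hloc, hden, hΔγ] with n hm hb hl hdn hΔn
  have hn := hb.pos hc
  have hs := hb.scale_pos hc
  have hsub : {ω | δ ≤ ‖|(M n).JK (H n) β₀ (ρhat n) ω - (M n).JKI (H n) β₀ ω|‖}
      ⊆ ({ω | T ≤ |(M n).numI (H n) β₀ ω|} ∪ {ω | (M n).denI (H n) β₀ ω ≤ d})
        ∪ {ω | γ ≤ ‖((M n).ΔN (H n) β₀ (ρhat n) ω, (M n).ΔD (H n) β₀ (ρhat n) ω)‖} := by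
    intro ω hω
    simp only [Set.mem_ofPred_eq, Set.mem_union, norm_abs_eq_norm, Real.norm_eq_abs] at hω ⊢
    by_contra! hcon
    obtain ⟨⟨hN, hD⟩, hx⟩ := hcon
    -- The product carries the maximum norm, so both errors are below `γ` at once.
    rw [Prod.norm_def, max_lt_iff, Real.norm_eq_abs, Real.norm_eq_abs] at hx
    have eN : (M n).scale (H n) β₀ / √n * ∑ i, (M n).nullError β₀ i ω
          * (M n).piHat (H n) β₀ (ρhat n) i ω
        = (M n).numI (H n) β₀ ω + (M n).ΔN (H n) β₀ (ρhat n) ω := by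
      rw [JackknifeIV.IVModel.numI, JackknifeIV.IVModel.ΔN, ← mul_add, ← Finset.sum_add_distrib]
      congr 1
      exact Finset.sum_congr rfl fun i _ => by ring
    have eD : (M n).scale (H n) β₀ ^ 2 / n * ∑ i, (M n).nullError β₀ i ω ^ 2
          * (M n).piHat (H n) β₀ (ρhat n) i ω ^ 2
        = (M n).denI (H n) β₀ ω + (M n).ΔD (H n) β₀ (ρhat n) ω := by
      rw [JackknifeIV.IVModel.denI, JackknifeIV.IVModel.ΔD, ← mul_add, ← Finset.sum_add_distrib]
      congr 1
      exact Finset.sum_congr rfl fun i _ => by ring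
    have hDpos : 0 < (M n).denI (H n) β₀ ω + (M n).ΔD (H n) β₀ (ρhat n) ω := by
      linarith [(abs_lt.1 hx.2).1]
    have e1 : (M n).JK (H n) β₀ (ρhat n) ω
        = ((M n).numI (H n) β₀ ω + (M n).ΔN (H n) β₀ (ρhat n) ω) ^ 2
          / ((M n).denI (H n) β₀ ω + (M n).ΔD (H n) β₀ (ρhat n) ω) := by
      rw [← eN, ← eD]
      exact JackknifeIV.kRatio_eq_div _ _ hs hn (by rw [eD]; exact hDpos)
    have e2 : (M n).JKI (H n) β₀ ω
        = (M n).numI (H n) β₀ ω ^ 2 / (M n).denI (H n) β₀ ω :=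
      JackknifeIV.kRatio_eq_div _ _ hs hn (hd.trans hD)
    rw [e1, e2] at hω
    have := JackknifeIV.abs_sq_div_sub_le hd hT0.le hN.le hD.le hx.1.le hx.2.le hγ1 hγd
    linarith
  have h1 : μ n {ω | T ≤ |(M n).numI (H n) β₀ ω|} ≤ ENNReal.ofReal (ε / 3) := by
    rw [← ofReal_measureReal, ← hTC]
    exact ENNReal.ofReal_le_ofReal
      (JackknifeIV.IVModel.measureReal_le_abs_numI_le hm hb hl hc (hH n) hT0)
  have h2 : μ n {ω | (M n).denI (H n) β₀ ω ≤ d} ≤ ENNReal.ofReal (ε / 3) := by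
    rw [← ofReal_measureReal]
    exact ENNReal.ofReal_le_ofReal (hdn (μ n) (M n) (H n) β₀ hm hb (hH n))
  calc μ n {ω | δ ≤ ‖|(M n).JK (H n) β₀ (ρhat n) ω - (M n).JKI (H n) β₀ ω|‖}
      ≤ ENNReal.ofReal (ε / 3) + ENNReal.ofReal (ε / 3) + ENNReal.ofReal (ε / 3) :=
        (measure_mono hsub).trans ((measure_union_le _ _).trans
          (add_le_add ((measure_union_le _ _).trans (add_le_add h1 h2)) hΔn))
    _ = ENNReal.ofReal ε := by
        rw [← ENNReal.ofReal_add (by positivity) (by positivity),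
          ← ENNReal.ofReal_add (by positivity) (by positivity)]
        congr 1; ring
    _ ≤ ε₀ := hεε₀
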